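/- Let $n \ge 0$ be an integer, $\alpha > 0$ and $D \ge 0$. Let $(X_t)_{t \ge 0}$ be the Ornstein--Uhlenbeck process in $\mathbb{R}^n$ with target measure $\nu = \mathcal{N}(0, \frac{1}{\alpha} I)$, that is, the solution of $dX = -\alpha X\,dt + \sqrt{2}\,dW$ with $W$ a standard Brownian motion independent of $X_0$; in law, for all $0 \le s \le t$, $$X_t = e^{-\alpha (t-s)} X_s + \sqrt{\tfrac{1-e^{-2\alpha (t-s)}}{\alpha}}\; Z, \qquad Z \sim \mathcal{N}(0,I) \text{ independent of } (X_r)_{0 \le r \le s}.$$ Suppose that the support of the law of $X_0$ is contained in a (closed) ball of diameter $D$. Let $I(X_0;X_t) \in [0,\infty]$ be the mutual information of $X_0$ and $X_t$, i.e. the Kullback--Leibler divergence of the joint law of $(X_0,X_t)$ from the product of the laws of $X_0$ and $X_t$, and put $$T = \frac{1}{2\alpha} \log\left(\sqrt{1+D^4\alpha^2} + D^2\alpha\right).$$ Then $I(X_0;X_t)$ is finite for all $t \ge T$, and $t \mapsto I(X_0;X_t)$ is convex on $[T,\infty)$. -/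

import Mathlib

open MeasureTheory ProbabilityTheory InformationTheory
open scoped ENNReal

/-- The mutual information `I(X;Y)` of two random variables on `(Ω, P)`: the Kullback-Leibler
divergence of their joint law from the product of their marginal laws, with values in `[0, ∞]`. -/
noncomputable def mutualInformation {Ω 𝓧 𝓨 : Type*} [MeasurableSpace Ω] [MeasurableSpace 𝓧]
    [MeasurableSpace 𝓨] (X : Ω → 𝓧) (Y : Ω → 𝓨) (P : Measure Ω) : ℝ≥0∞ :=
  klDiv (P.map (fun ω => (X ω, Y ω))) ((P.map X).prod (P.map Y))

/-- The variance per coordinate `τ_α(t) = (1 - e^{-2αt}) / α` accumulated in time `t` by the noise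
of the Ornstein-Uhlenbeck process with target `N(0, I/α)`. -/
noncomputable def ouVariance (α t : ℝ) : ℝ :=
  (1 - Real.exp (-2 * α * t)) / α

/-- The centred Gaussian law `N(0, v I)` on `ℝⁿ`, as the law of `√v Z` with `Z ∼ N(0, I)`. -/
noncomputable def isotropicGaussian (n : ℕ) (v : ℝ) : Measure (EuclideanSpace ℝ (Fin n)) :=
  (stdGaussian (EuclideanSpace ℝ (Fin n))).map (fun z => Real.sqrt v • z)

/-- `X = (X_t)_{t ≥ 0}` is (in law) an Ornstein-Uhlenbeck process in `ℝⁿ` with target measure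
`N(0, I/α)`, i.e. it has the finite-dimensional laws of the solution of
`dX = -α X dt + √2 dW` started from `X_0` independent of `W`: for all `0 ≤ s ≤ t`,
`X_t = e^{-α(t-s)} X_s + √(τ_α(t-s)) Z` with `Z ∼ N(0, I)` independent of the past `(X_r)_{0 ≤ r ≤ s}`.
In particular, given `X_0 = x`, the variable `X_t` has law `N(e^{-αt} x, τ_α(t) I)`.
The law of `X_0` is arbitrary, and the values of `X` at negative times play no role. -/
structure IsOUProcess {Ω : Type*} [MeasurableSpace Ω] {n : ℕ} (α : ℝ)
    (X : ℝ → Ω → EuclideanSpace ℝ (Fin n)) (P : Measure Ω) : Prop where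
  aemeasurable : ∀ t : ℝ, 0 ≤ t → AEMeasurable (X t) P
  hasLaw_noise : ∀ s t : ℝ, 0 ≤ s → s ≤ t →
    HasLaw (fun ω => X t ω - Real.exp (-α * (t - s)) • X s ω)
      (isotropicGaussian n (ouVariance α (t - s))) P
  indepFun_noise : ∀ s t : ℝ, 0 ≤ s → s ≤ t →
    IndepFun (fun ω (r : Set.Icc 0 s) => X r ω)
      (fun ω => X t ω - Real.exp (-α * (t - s)) • X s ω) P

/-- A measure on `ℝⁿ` is `D`-bounded if its support is contained in a ball of diameter `D`, that is,
in a closed ball of radius `D / 2`. -/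
def IsDBounded {n : ℕ} (D : ℝ) (ρ : Measure (EuclideanSpace ℝ (Fin n))) : Prop :=
  ∃ c : EuclideanSpace ℝ (Fin n), ρ.support ⊆ Metric.closedBall c (D / 2)

/-! Rescaling `X t` turns the flow into a Gaussian channel s x + √s Z with signal-to-noise ratio s =
α / (e^{2αt} - 1) (`IsOUProcess.mutualInformation_eq`). Let J(s) be the information of the channel
and M(s) its minimal mean square error. Since J' = M/2 and ds/dt = -2s(s + α), the time derivative
is -M(s) s (s + α). As s decreases in t, convexity says that M(s) s (s + α) is nondecreasing in s on
(0, s(T)]. Write it as the product of e^{ls} M(s) and s(s + α) e^{-ls} with l = 2D². The first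
factor is nondecreasing because the posteriors live in a ball of radius R = D/2 and so have variance
at most R², which limits the decay of M. The second is nondecreasing up to s(T) because e^{2αT} is
the positive root of w² - 1 = lαw.

All facts about J' and the decay of M come from increments, without differentiating an integral:
J(s) + (δ/2 - R²δ²) M(s) ≤ J(s + δ) ≤ J(s) + (δ/2) M(s), the lower bound for 4R²δ ≤ 1
(`le_channelInformation_add`, `channelInformation_add_le`). Observing at level s + δ amounts to
observing at level s and then independently at level δ, with the posterior as new prior
(`mixtureEntropy_add`). This leaves the relative entropy at small δ, which is compared with N(δm,
δI), m being the mean (`le_mixtureEntropy`, `mixtureEntropy_le`). Playing the two bounds against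
each other on adjacent intervals gives J' = M/2 (`hasDerivAt_of_increments`) and e^{-8R²(r-s)} M(s)
≤ M(r) (`le_exp_mul_of_increments`), where 8R² = l. -/

open scoped RealInnerProductSpace

/-! ### Isotropic Gaussians and the Cameron-Martin density -/

section Gaussian

variable {n : ℕ}

instance isProbabilityMeasure_isotropicGaussian (v : ℝ) :
    IsProbabilityMeasure (isotropicGaussian n v) :=
  Measure.isProbabilityMeasure_map (by fun_prop)

lemma charFun_isotropicGaussian {v : ℝ} (hv : 0 ≤ v) (t : EuclideanSpace ℝ (Fin n)) :
    charFun (isotropicGaussian n v) t = Complex.exp (-(v * ‖t‖ ^ 2) / 2) := by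
  rw [isotropicGaussian, charFun_map_smul, charFun_stdGaussian, norm_smul, Real.norm_eq_abs,
    ← Complex.ofReal_pow, mul_pow, sq_abs, Real.sq_sqrt hv]
  push_cast
  rfl

lemma isotropicGaussian_map_add {v w : ℝ} (hv : 0 ≤ v) (hw : 0 ≤ w) :
    ((isotropicGaussian n v).prod (isotropicGaussian n w)).map (fun p => p.1 + p.2) =
      isotropicGaussian n (v + w) := by
  change Measure.conv _ _ = _
  apply Measure.ext_of_charFun
  ext t
  rw [charFun_conv, charFun_isotropicGaussian hv, charFun_isotropicGaussian hw,
    charFun_isotropicGaussian (add_nonneg hv hw), ← Complex.exp_add]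
  push_cast
  ring_nf

lemma isotropicGaussian_map_smul {v : ℝ} (hv : 0 ≤ v) (a : ℝ) :
    (isotropicGaussian n v).map (fun z => a • z) = isotropicGaussian n (a ^ 2 * v) := by
  apply Measure.ext_of_charFun
  ext t
  rw [charFun_map_smul, charFun_isotropicGaussian hv, charFun_isotropicGaussian (by positivity),
    norm_smul, Real.norm_eq_abs, ← Complex.ofReal_pow, mul_pow, sq_abs]
  push_cast
  ring_nf

instance isGaussian_isotropicGaussian (v : ℝ) : IsGaussian (isotropicGaussian n v) := by
  have : isotropicGaussian n v = (stdGaussian (EuclideanSpace ℝ (Fin n))).map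
      (Real.sqrt v • ContinuousLinearMap.id ℝ (EuclideanSpace ℝ (Fin n))) := rfl
  rw [this]
  infer_instance

/-- Fernique's theorem and A r ≤ C r² + A²/(4C). Integrability over the noise below is reduced to
this by bounds exponential in ‖b‖, logarithms being absorbed by y ≤ e^y. -/
lemma integrable_exp_mul_norm {E : Type*} [NormedAddCommGroup E] [NormedSpace ℝ E]
    [MeasurableSpace E] [BorelSpace E] [SecondCountableTopology E] [CompleteSpace E]
    (μ : Measure E) [IsGaussian μ] (A : ℝ) : Integrable (fun b => Real.exp (A * ‖b‖)) μ := by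
  obtain ⟨C, hC, hint⟩ := IsGaussian.exists_integrable_exp_sq μ
  refine (hint.const_mul (Real.exp (A ^ 2 / (4 * C)))).mono' (by fun_prop) (ae_of_all _ fun b => ?_)
  rw [Real.norm_eq_abs, Real.abs_exp, ← Real.exp_add, Real.exp_le_exp]
  have h : A ^ 2 / (4 * C) + C * ‖b‖ ^ 2 - A * ‖b‖ = (A - 2 * C * ‖b‖) ^ 2 / (4 * C) := by
    field_simp
    ring
  have : 0 ≤ (A - 2 * C * ‖b‖) ^ 2 / (4 * C) := by positivity
  linarith

/-- The integrand factors over coordinates, leaving the one-dimensional complex moment generating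
function at x i + t i * I. The real part is needed to compute characteristic functions of tilted
Gaussians. -/
lemma integral_cexp_stdGaussian (x t : EuclideanSpace ℝ (Fin n)) :
    ∫ z, Complex.exp (⟪x, z⟫ + ⟪t, z⟫ * Complex.I) ∂(stdGaussian (EuclideanSpace ℝ (Fin n))) =
      Complex.exp ((‖x‖ ^ 2 - ‖t‖ ^ 2) / 2 + ⟪x, t⟫ * Complex.I) := by
  rw [← map_pi_eq_stdGaussian, integral_map (Measurable.aemeasurable (by fun_prop))
    (Measurable.aestronglyMeasurable (by fun_prop))]
  have h : ∀ y : Fin n → ℝ, Complex.exp (⟪x, WithLp.toLp 2 y⟫ + ⟪t, WithLp.toLp 2 y⟫ * Complex.I) =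
      ∏ i, Complex.exp ((x i + t i * Complex.I) * y i) := by
    intro y
    rw [← Complex.exp_sum]
    congr 1
    simp only [PiLp.inner_apply, RCLike.inner_apply, conj_trivial]
    push_cast
    rw [Finset.sum_mul, ← Finset.sum_add_distrib]
    exact Finset.sum_congr rfl fun i _ => by ring
  simp_rw [h]
  rw [integral_fintype_prod_eq_prod (f := fun i (y : ℝ) => Complex.exp ((x i + t i * Complex.I) * y))]
  have h1 : ∀ z : ℂ, ∫ y : ℝ, Complex.exp (z * y) ∂(gaussianReal 0 1) = Complex.exp (z ^ 2 / 2) := by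
    intro z
    have := complexMGF_id_gaussianReal (μ := 0) (v := 1) z
    simpa [complexMGF] using this
  simp_rw [h1]
  rw [← Complex.exp_sum]
  congr 1
  rw [← Complex.ofReal_pow, ← Complex.ofReal_pow, EuclideanSpace.real_norm_sq_eq,
    EuclideanSpace.real_norm_sq_eq]
  simp only [PiLp.inner_apply, RCLike.inner_apply, conj_trivial]
  push_cast
  rw [← Finset.sum_sub_distrib, Finset.sum_mul, Finset.sum_div, ← Finset.sum_add_distrib]
  refine Finset.sum_congr rfl fun i _ => ?_
  linear_combination (t i : ℂ) ^ 2 / 2 * Complex.I_sq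

lemma integral_cexp_isotropicGaussian {s : ℝ} (hs : 0 ≤ s) (x t : EuclideanSpace ℝ (Fin n)) :
    ∫ z, Complex.exp (⟪x, z⟫ + ⟪t, z⟫ * Complex.I) ∂(isotropicGaussian n s) =
      Complex.exp (s * (‖x‖ ^ 2 - ‖t‖ ^ 2) / 2 + s * ⟪x, t⟫ * Complex.I) := by
  rw [isotropicGaussian, integral_map (Measurable.aemeasurable (by fun_prop))
    (Measurable.aestronglyMeasurable (by fun_prop))]
  have := integral_cexp_stdGaussian (√s • x) (√s • t)
  simp only [real_inner_smul_left, norm_smul, real_inner_smul_right, Real.norm_eq_abs,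
    abs_of_nonneg (Real.sqrt_nonneg s)] at this ⊢
  rw [this]
  congr 1
  have h2 : ((√s : ℝ) : ℂ) ^ 2 = s := by rw [← Complex.ofReal_pow, Real.sq_sqrt hs]
  push_cast
  rw [mul_pow, mul_pow, h2, ← mul_assoc, ← sq, h2]
  ring

/-- The density at `b` of `N(s x, s I)` with respect to `N(0, s I)`. -/
noncomputable def shiftDensity (s : ℝ) (x b : EuclideanSpace ℝ (Fin n)) : ℝ :=
  Real.exp (⟪x, b⟫ - s * ‖x‖ ^ 2 / 2)

lemma shiftDensity_pos (s : ℝ) (x b : EuclideanSpace ℝ (Fin n)) : 0 < shiftDensity s x b :=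
  Real.exp_pos _

@[fun_prop]
lemma continuous_shiftDensity (s : ℝ) :
    Continuous (fun p : EuclideanSpace ℝ (Fin n) × EuclideanSpace ℝ (Fin n) =>
      shiftDensity s p.1 p.2) := by
  unfold shiftDensity
  fun_prop

lemma continuous_shiftDensity_left (s : ℝ) (b : EuclideanSpace ℝ (Fin n)) :
    Continuous (fun x => shiftDensity s x b) := by
  unfold shiftDensity
  fun_prop

lemma continuous_shiftDensity_right (s : ℝ) (x : EuclideanSpace ℝ (Fin n)) :
    Continuous (shiftDensity s x) := by
  unfold shiftDensity
  fun_prop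

lemma shiftDensity_le {s B : ℝ} (hs : 0 ≤ s) {x : EuclideanSpace ℝ (Fin n)} (hx : ‖x‖ ≤ B)
    (b : EuclideanSpace ℝ (Fin n)) : shiftDensity s x b ≤ Real.exp (B * ‖b‖) := by
  rw [shiftDensity, Real.exp_le_exp]
  have h1 := real_inner_le_norm x b
  have h2 := mul_le_mul_of_nonneg_right hx (norm_nonneg b)
  have : 0 ≤ s * ‖x‖ ^ 2 / 2 := by positivity
  linarith

lemma le_shiftDensity {s B : ℝ} (hs : 0 ≤ s) {x : EuclideanSpace ℝ (Fin n)} (hx : ‖x‖ ≤ B)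
    (b : EuclideanSpace ℝ (Fin n)) :
    Real.exp (-(B * ‖b‖ + s * B ^ 2 / 2)) ≤ shiftDensity s x b := by
  rw [shiftDensity, Real.exp_le_exp]
  have h1 := neg_le_of_abs_le (abs_real_inner_le_norm x b)
  have h2 := mul_le_mul_of_nonneg_right hx (norm_nonneg b)
  have : s * ‖x‖ ^ 2 / 2 ≤ s * B ^ 2 / 2 := by gcongr
  linarith

lemma integrable_shiftDensity {s : ℝ} (hs : 0 ≤ s) (x : EuclideanSpace ℝ (Fin n)) :
    Integrable (shiftDensity s x) (isotropicGaussian n s) := by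
  refine (integrable_exp_mul_norm _ ‖x‖).mono'
    (continuous_shiftDensity_right s x).aestronglyMeasurable (ae_of_all _ fun b => ?_)
  rw [Real.norm_of_nonneg (shiftDensity_pos s x b).le]
  exact shiftDensity_le hs le_rfl b

/-- The Cameron-Martin formula. -/
lemma withDensity_shiftDensity {s : ℝ} (hs : 0 ≤ s) (x : EuclideanSpace ℝ (Fin n)) :
    (isotropicGaussian n s).withDensity (fun b => ENNReal.ofReal (shiftDensity s x b)) =
      (isotropicGaussian n s).map (fun z => s • x + z) := by
  have := isFiniteMeasure_withDensity_ofReal (integrable_shiftDensity hs x).2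
  apply Measure.ext_of_charFun
  ext t
  have hm := (continuous_shiftDensity_right s x).measurable
  rw [charFun_apply, charFun_apply, integral_map (by fun_prop)
    (Measurable.aestronglyMeasurable (by fun_prop))]
  rw [integral_withDensity_eq_integral_toReal_smul (by fun_prop) (by simp)]
  have h0 : ∀ b, (ENNReal.ofReal (shiftDensity s x b)).toReal •
      Complex.exp (⟪b, t⟫ * Complex.I) = Complex.exp (-(s * ‖x‖ ^ 2 / 2)) *
        Complex.exp (⟪x, b⟫ + ⟪t, b⟫ * Complex.I) := by
    intro b
    rw [ENNReal.toReal_ofReal (shiftDensity_pos s x b).le, shiftDensity, Complex.real_smul,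
      Complex.ofReal_exp, ← Complex.exp_add, ← Complex.exp_add, real_inner_comm t b]
    push_cast
    ring_nf
  simp_rw [h0]
  rw [integral_const_mul, integral_cexp_isotropicGaussian hs, ← Complex.exp_add]
  have h1 : ∀ z, Complex.exp (⟪s • x + z, t⟫ * Complex.I) =
      Complex.exp (s * ⟪x, t⟫ * Complex.I) * Complex.exp (⟪z, t⟫ * Complex.I) := by
    intro z
    rw [← Complex.exp_add, inner_add_left, real_inner_smul_left]
    push_cast
    ring_nf
  simp_rw [h1]
  rw [integral_const_mul, ← charFun_apply, charFun_isotropicGaussian hs, ← Complex.exp_add]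
  ring_nf

lemma integral_shiftDensity_mul {s : ℝ} (hs : 0 ≤ s) (x : EuclideanSpace ℝ (Fin n))
    {f : EuclideanSpace ℝ (Fin n) → ℝ} (hf : Measurable f) :
    ∫ b, shiftDensity s x b * f b ∂(isotropicGaussian n s) =
      ∫ z, f (s • x + z) ∂(isotropicGaussian n s) := by
  have hm := (continuous_shiftDensity_right s x).measurable
  rw [← integral_map (f := f) (by fun_prop) hf.aestronglyMeasurable, ← withDensity_shiftDensity hs,
    integral_withDensity_eq_integral_toReal_smul (by fun_prop) (by simp)]
  simp_rw [ENNReal.toReal_ofReal (shiftDensity_pos s x _).le, smul_eq_mul]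

lemma integral_shiftDensity {s : ℝ} (hs : 0 ≤ s) (x : EuclideanSpace ℝ (Fin n)) :
    ∫ b, shiftDensity s x b ∂(isotropicGaussian n s) = 1 := by
  simpa using integral_shiftDensity_mul hs x (f := fun _ => 1) measurable_const

lemma integral_shiftDensity_mul_inner {s : ℝ} (hs : 0 ≤ s) (x m : EuclideanSpace ℝ (Fin n)) :
    ∫ b, shiftDensity s x b * ⟪m, b⟫ ∂(isotropicGaussian n s) = s * ⟪m, x⟫ := by
  rw [integral_shiftDensity_mul hs x (by fun_prop)]
  have hint : Integrable (fun z => ⟪m, z⟫) (isotropicGaussian n s) :=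
    (IsGaussian.integrable_id (μ := isotropicGaussian n s)).const_inner m
  have hmean : ∫ z, ⟪m, z⟫ ∂(isotropicGaussian n s) = 0 := by
    rw [isotropicGaussian, integral_map (by fun_prop) (by fun_prop)]
    have := integral_strongDual_stdGaussian (innerSL ℝ m)
    simp only [innerSL_apply_apply] at this
    simp only [real_inner_smul_right]
    rw [integral_const_mul, this, mul_zero]
  simp_rw [inner_add_right, real_inner_smul_right]
  rw [integral_add (integrable_const _) hint, hmean]
  simp

end Gaussian

/-! ### Relative entropy of a Gaussian mixture, with second-order bounds at small noise level -/

section Mixture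

variable {n : ℕ}

lemma integrable_of_continuous_of_ae_norm_le {E F : Type*} [NormedAddCommGroup E] [ProperSpace E]
    [MeasurableSpace E] [OpensMeasurableSpace E] [NormedAddCommGroup F]
    [SecondCountableTopologyEither E F] {μ : Measure E} [IsFiniteMeasure μ] {B : ℝ}
    (hB : ∀ᵐ x ∂μ, ‖x‖ ≤ B) {f : E → F} (hf : Continuous f) : Integrable f μ := by
  obtain ⟨C, hC⟩ := (isCompact_closedBall (0 : E) B).exists_bound_of_continuousOn hf.continuousOn
  refine (integrable_const C).mono' hf.aestronglyMeasurable ?_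
  filter_upwards [hB] with x hx
  exact hC x (by simpa using hx)

lemma integrable_prod_of_norm_le_exp {𝓧 E : Type*} [MeasurableSpace 𝓧] [NormedAddCommGroup E]
    [NormedSpace ℝ E] [MeasurableSpace E] [BorelSpace E] [SecondCountableTopology E]
    [CompleteSpace E] {π : Measure 𝓧} [IsFiniteMeasure π] {γ : Measure E} [IsGaussian γ]
    {F : 𝓧 × E → ℝ} {A C : ℝ} (hF : AEStronglyMeasurable F (π.prod γ))
    (h : ∀ᵐ x ∂π, ∀ b, |F (x, b)| ≤ C * Real.exp (A * ‖b‖)) : Integrable F (π.prod γ) := by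
  refine (((integrable_exp_mul_norm γ A).const_mul C).comp_snd π).mono' hF ?_
  filter_upwards [Measure.quasiMeasurePreserving_fst.ae h] with p hp
  exact hp p.2

/-- The density at `b` of `s X + √s Z`, where `X ∼ μ` and `Z ∼ N(0, I)` are independent, with
respect to `N(0, s I)`. -/
noncomputable def mixtureDensity (μ : Measure (EuclideanSpace ℝ (Fin n))) (s : ℝ)
    (b : EuclideanSpace ℝ (Fin n)) : ℝ :=
  ∫ x, shiftDensity s x b ∂μ

/-- The relative entropy of the law of `s X + √s Z`, where `X ∼ μ` and `Z ∼ N(0, I)` are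
independent, with respect to `N(0, s I)`. -/
noncomputable def mixtureEntropy (μ : Measure (EuclideanSpace ℝ (Fin n))) (s : ℝ) : ℝ :=
  ∫ b, mixtureDensity μ s b * Real.log (mixtureDensity μ s b) ∂(isotropicGaussian n s)

/-- The trace of the covariance of `μ`. -/
noncomputable def totalVariance (μ : Measure (EuclideanSpace ℝ (Fin n))) : ℝ :=
  ∫ x, ‖x - ∫ y, y ∂μ‖ ^ 2 ∂μ

lemma totalVariance_nonneg (μ : Measure (EuclideanSpace ℝ (Fin n))) : 0 ≤ totalVariance μ := integral_nonneg fun _ => by positivity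

lemma nonneg_of_ae_norm_le {E : Type*} [NormedAddCommGroup E] [MeasurableSpace E] {μ : Measure E}
    [IsProbabilityMeasure μ] {B : ℝ} (hB : ∀ᵐ x ∂μ, ‖x‖ ≤ B) : 0 ≤ B := by
  obtain ⟨x, hx⟩ := hB.exists
  exact (norm_nonneg x).trans hx

variable {μ : Measure (EuclideanSpace ℝ (Fin n))} [IsProbabilityMeasure μ]

lemma measurable_mixtureDensity (s : ℝ) : Measurable (mixtureDensity μ s) := by
  have h : StronglyMeasurable (fun p : EuclideanSpace ℝ (Fin n) × EuclideanSpace ℝ (Fin n) =>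
      shiftDensity s p.1 p.2) := (continuous_shiftDensity s).stronglyMeasurable
  exact h.integral_prod_left'.measurable

lemma mixtureDensity_le {B s : ℝ} (hB : ∀ᵐ x ∂μ, ‖x‖ ≤ B) (hs : 0 ≤ s)
    (b : EuclideanSpace ℝ (Fin n)) : mixtureDensity μ s b ≤ Real.exp (B * ‖b‖) := by
  have h := integral_mono_ae
    (integrable_of_continuous_of_ae_norm_le hB (continuous_shiftDensity_left s b))
    (integrable_const (Real.exp (B * ‖b‖)))
    (by filter_upwards [hB] with x hx using shiftDensity_le hs hx b)
  rw [mixtureDensity]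
  simpa using h

lemma le_mixtureDensity {B s : ℝ} (hB : ∀ᵐ x ∂μ, ‖x‖ ≤ B) (hs : 0 ≤ s)
    (b : EuclideanSpace ℝ (Fin n)) :
    Real.exp (-(B * ‖b‖ + s * B ^ 2 / 2)) ≤ mixtureDensity μ s b := by
  have h := integral_mono_ae (integrable_const (Real.exp (-(B * ‖b‖ + s * B ^ 2 / 2))))
    (integrable_of_continuous_of_ae_norm_le hB (continuous_shiftDensity_left s b))
    (by filter_upwards [hB] with x hx using le_shiftDensity hs hx b)
  rw [mixtureDensity]
  simpa only [integral_const, probReal_univ, one_smul] using h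

lemma mixtureDensity_pos {B s : ℝ} (hB : ∀ᵐ x ∂μ, ‖x‖ ≤ B) (hs : 0 ≤ s)
    (b : EuclideanSpace ℝ (Fin n)) : 0 < mixtureDensity μ s b :=
  (Real.exp_pos _).trans_le (le_mixtureDensity hB hs b)

lemma abs_log_mixtureDensity_le {B s : ℝ} (hB : ∀ᵐ x ∂μ, ‖x‖ ≤ B) (hs : 0 ≤ s)
    (b : EuclideanSpace ℝ (Fin n)) :
    |Real.log (mixtureDensity μ s b)| ≤ B * ‖b‖ + s * B ^ 2 / 2 := by
  have hpos := mixtureDensity_pos hB hs b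
  rw [abs_le]
  constructor
  · rw [Real.le_log_iff_exp_le hpos]
    exact le_mixtureDensity hB hs b
  · refine ((Real.log_le_iff_le_exp hpos).2 (mixtureDensity_le hB hs b)).trans ?_
    have : 0 ≤ s * B ^ 2 / 2 := by positivity
    linarith

lemma abs_mixtureDensity_mul_log_le {B s : ℝ} (hB : ∀ᵐ x ∂μ, ‖x‖ ≤ B) (hs : 0 ≤ s)
    (b : EuclideanSpace ℝ (Fin n)) :
    |mixtureDensity μ s b * Real.log (mixtureDensity μ s b)| ≤
      Real.exp (s * B ^ 2 / 2) * Real.exp (2 * B * ‖b‖) := by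
  have h1 := abs_log_mixtureDensity_le hB hs b
  have h2 : B * ‖b‖ + s * B ^ 2 / 2 ≤ Real.exp (B * ‖b‖ + s * B ^ 2 / 2) :=
    (lt_add_one _).le.trans (Real.add_one_le_exp _)
  rw [abs_mul, abs_of_pos (mixtureDensity_pos hB hs b)]
  calc _ ≤ Real.exp (B * ‖b‖) * Real.exp (B * ‖b‖ + s * B ^ 2 / 2) :=
        mul_le_mul (mixtureDensity_le hB hs b) (h1.trans h2) (abs_nonneg _) (Real.exp_pos _).le
    _ = _ := by
        rw [← Real.exp_add, ← Real.exp_add]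
        ring_nf

lemma integrable_of_abs_le_exp {f : EuclideanSpace ℝ (Fin n) → ℝ} {s A C : ℝ}
    (hf : AEStronglyMeasurable f (isotropicGaussian n s))
    (h : ∀ b, |f b| ≤ C * Real.exp (A * ‖b‖)) : Integrable f (isotropicGaussian n s) :=
  ((integrable_exp_mul_norm _ A).const_mul C).mono' hf (ae_of_all _ h)

lemma integrable_mixtureDensity {B s : ℝ} (hB : ∀ᵐ x ∂μ, ‖x‖ ≤ B) (hs : 0 ≤ s) :
    Integrable (mixtureDensity μ s) (isotropicGaussian n s) := by
  refine integrable_of_abs_le_exp (C := 1) (A := B)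
    (measurable_mixtureDensity s).aestronglyMeasurable fun b => ?_
  rw [abs_of_pos (mixtureDensity_pos hB hs b), one_mul]
  exact mixtureDensity_le hB hs b

lemma integrable_mixtureDensity_mul_log {B s : ℝ} (hB : ∀ᵐ x ∂μ, ‖x‖ ≤ B) (hs : 0 ≤ s) :
    Integrable (fun b => mixtureDensity μ s b * Real.log (mixtureDensity μ s b))
      (isotropicGaussian n s) :=
  integrable_of_abs_le_exp ((measurable_mixtureDensity s).mul
    (measurable_mixtureDensity s).log).aestronglyMeasurable
    fun b => abs_mixtureDensity_mul_log_le hB hs b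

/-- Fubini's theorem for the mixture, against a weight of at most exponential growth. -/
lemma integral_integral_shiftDensity_mul {B s A C : ℝ} (hB : ∀ᵐ x ∂μ, ‖x‖ ≤ B) (hs : 0 ≤ s)
    {f : EuclideanSpace ℝ (Fin n) → EuclideanSpace ℝ (Fin n) → ℝ}
    (hf : Continuous (Function.uncurry f))
    (hle : ∀ᵐ x ∂μ, ∀ b, |f x b| ≤ C * Real.exp (A * ‖b‖)) :
    ∫ b, ∫ x, shiftDensity s x b * f x b ∂μ ∂(isotropicGaussian n s) =
      ∫ x, ∫ b, shiftDensity s x b * f x b ∂(isotropicGaussian n s) ∂μ := by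
  rw [← integral_integral_swap]
  refine integrable_prod_of_norm_le_exp (A := B + A) (C := C) ?_ ?_
  · exact ((continuous_shiftDensity s).mul hf).aestronglyMeasurable
  · filter_upwards [hB, hle] with x hx hle b
    rw [Function.uncurry_apply_pair, abs_mul, abs_of_pos (shiftDensity_pos s x b)]
    calc _ ≤ Real.exp (B * ‖b‖) * (C * Real.exp (A * ‖b‖)) :=
          mul_le_mul (shiftDensity_le hs hx b) (hle b) (abs_nonneg _) (Real.exp_pos _).le
      _ = _ := by rw [add_mul, Real.exp_add]; ring

lemma integral_mixtureDensity {B s : ℝ} (hB : ∀ᵐ x ∂μ, ‖x‖ ≤ B) (hs : 0 ≤ s) :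
    ∫ b, mixtureDensity μ s b ∂(isotropicGaussian n s) = 1 := by
  have h := integral_integral_shiftDensity_mul (A := 0) (C := 1) hB hs (f := fun _ _ => 1)
    (by fun_prop) (by simp)
  simp only [mul_one, integral_shiftDensity hs] at h
  simpa [mixtureDensity] using h

lemma integral_mixtureDensity_mul_inner {B s : ℝ} (hB : ∀ᵐ x ∂μ, ‖x‖ ≤ B) (hs : 0 ≤ s)
    (m : EuclideanSpace ℝ (Fin n)) :
    ∫ b, mixtureDensity μ s b * ⟪m, b⟫ ∂(isotropicGaussian n s) = s * ⟪m, ∫ x, x ∂μ⟫ := by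
  have hx : Integrable (fun x => x) μ := integrable_of_continuous_of_ae_norm_le hB continuous_id
  have h := integral_integral_shiftDensity_mul (A := 1) (C := ‖m‖) hB hs (f := fun _ b => ⟪m, b⟫)
    (by fun_prop) (ae_of_all _ fun _ b => by
      refine (abs_real_inner_le_norm m b).trans ?_
      gcongr
      rw [one_mul]
      exact (lt_add_one _).le.trans (Real.add_one_le_exp _))
  simp only [integral_shiftDensity_mul_inner hs, integral_mul_const, integral_const_mul] at h
  rw [← integral_inner hx]
  exact h

lemma integrable_mixtureDensity_mul_inner {B s : ℝ} (hB : ∀ᵐ x ∂μ, ‖x‖ ≤ B) (hs : 0 ≤ s)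
    (m : EuclideanSpace ℝ (Fin n)) :
    Integrable (fun b => mixtureDensity μ s b * ⟪m, b⟫) (isotropicGaussian n s) := by
  refine integrable_of_abs_le_exp (C := ‖m‖) (A := B + 1)
    ((measurable_mixtureDensity s).mul (by fun_prop)).aestronglyMeasurable fun b => ?_
  have h1 : ‖b‖ ≤ Real.exp ‖b‖ := (lt_add_one _).le.trans (Real.add_one_le_exp _)
  rw [abs_mul, abs_of_pos (mixtureDensity_pos hB hs b), add_mul, Real.exp_add, one_mul,
    mul_left_comm]
  refine mul_le_mul (mixtureDensity_le hB hs b) ?_ (abs_nonneg _) (Real.exp_pos _).le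
  exact (abs_real_inner_le_norm m b).trans (by gcongr)

/-- Bias-variance decomposition: the cross term vanishes because x - m has mean zero. -/
lemma integral_norm_sub_sq {B : ℝ} (hB : ∀ᵐ x ∂μ, ‖x‖ ≤ B) (c : EuclideanSpace ℝ (Fin n)) :
    ∫ x, ‖x - c‖ ^ 2 ∂μ = totalVariance μ + ‖∫ x, x ∂μ - c‖ ^ 2 := by
  set m := ∫ x, x ∂μ with hm
  have hx : Integrable (fun x => x) μ := integrable_of_continuous_of_ae_norm_le hB continuous_id
  have hxm : Integrable (fun x => x - m) μ := hx.sub (integrable_const m)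
  have h1 : ∀ x, ‖x - c‖ ^ 2 = ‖x - m‖ ^ 2 + 2 * ⟪m - c, x - m⟫ + ‖m - c‖ ^ 2 := by
    intro x
    rw [← sub_add_sub_cancel x m c, norm_add_sq_real, real_inner_comm]
  rw [integral_congr_ae (ae_of_all _ h1)]
  rw [integral_add, integral_add, integral_const_mul,
    integral_inner hxm, integral_sub hx (integrable_const m)]
  · rw [← hm, integral_const, integral_const, probReal_univ, one_smul, one_smul, sub_self,
      inner_zero_right, mul_zero, add_zero, totalVariance]
  all_goals exact integrable_of_continuous_of_ae_norm_le hB (by fun_prop)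

lemma totalVariance_le {B R : ℝ} {c : EuclideanSpace ℝ (Fin n)} (hB : ∀ᵐ x ∂μ, ‖x‖ ≤ B)
    (hR : ∀ᵐ x ∂μ, ‖x - c‖ ≤ R) : totalVariance μ ≤ R ^ 2 := by
  have h := integral_norm_sub_sq hB c
  have h2 : ∫ x, ‖x - c‖ ^ 2 ∂μ ≤ ∫ _, R ^ 2 ∂μ := by
    refine integral_mono_ae (integrable_of_continuous_of_ae_norm_le hB (by fun_prop))
      (integrable_const _) ?_
    filter_upwards [hR] with x hx
    gcongr
  simp only [integral_const, probReal_univ, one_smul] at h2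
  nlinarith [sq_nonneg ‖∫ x, x ∂μ - c‖]

/-- The mean lies in the same ball as the support, so the distance is at most a diameter. -/
lemma norm_sub_mean_le {B R : ℝ} {c : EuclideanSpace ℝ (Fin n)} (hB : ∀ᵐ x ∂μ, ‖x‖ ≤ B)
    (hR : ∀ᵐ x ∂μ, ‖x - c‖ ≤ R) : ∀ᵐ x ∂μ, ‖x - ∫ y, y ∂μ‖ ≤ 2 * R := by
  have hx : Integrable (fun x => x) μ := integrable_of_continuous_of_ae_norm_le hB continuous_id
  have h1 : ‖∫ y, y ∂μ - c‖ ≤ R := by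
    have h := norm_integral_le_of_norm_le_const hR
    rw [integral_sub hx (integrable_const c)] at h
    simpa using h
  filter_upwards [hR] with x hx
  calc ‖x - ∫ y, y ∂μ‖ = ‖(x - c) - (∫ y, y ∂μ - c)‖ := by congr 1; abel
    _ ≤ R + R := (norm_sub_le _ _).trans (add_le_add hx h1)
    _ = 2 * R := by ring

/-- From 1 + y ≤ e^y at y = g - log a. Integrated with densities a and e^g, it is the Gibbs
inequality. -/
lemma mul_log_ge {a g : ℝ} (ha : 0 < a) : a * g + a - Real.exp g ≤ a * Real.log a := by
  have h := mul_le_mul_of_nonneg_left (Real.add_one_le_exp (g - Real.log a)) ha.le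
  rw [Real.exp_sub, Real.exp_log ha, mul_div_cancel₀ _ ha.ne'] at h
  linarith

/-- The same inequality at y = log a - g. Integrated, it bounds relative entropy by the chi-square
divergence. -/
lemma mul_log_le {a g : ℝ} (ha : 0 < a) :
    a * Real.log a ≤ a * g + a ^ 2 * Real.exp (-g) - a := by
  have h := mul_le_mul_of_nonneg_left (Real.add_one_le_exp (Real.log a - g)) ha.le
  rw [sub_eq_add_neg _ g, Real.exp_add, Real.exp_log ha] at h
  nlinarith

lemma integral_mixtureDensity_mul_log_shiftDensity {B δ : ℝ} (hB : ∀ᵐ x ∂μ, ‖x‖ ≤ B)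
    (hδ : 0 ≤ δ) (m : EuclideanSpace ℝ (Fin n)) :
    Integrable (fun b => mixtureDensity μ δ b * (⟪m, b⟫ - δ * ‖m‖ ^ 2 / 2))
      (isotropicGaussian n δ) ∧
    ∫ b, mixtureDensity μ δ b * (⟪m, b⟫ - δ * ‖m‖ ^ 2 / 2) ∂(isotropicGaussian n δ) =
      δ * ⟪m, ∫ x, x ∂μ⟫ - δ * ‖m‖ ^ 2 / 2 := by
  have h1 := integrable_mixtureDensity_mul_inner hB hδ m
  have h2 := (integrable_mixtureDensity hB hδ).mul_const (δ * ‖m‖ ^ 2 / 2)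
  simp_rw [mul_sub]
  refine ⟨h1.sub h2, ?_⟩
  rw [integral_sub h1 h2, integral_mixtureDensity_mul_inner hB hδ, integral_mul_const,
    integral_mixtureDensity hB hδ, one_mul]

/-- Gibbs inequality against N(δm, δI), where m is the mean of μ; the trial log-density is affine in
b, so only m enters its integral. -/
lemma le_mixtureEntropy {B δ : ℝ} (hB : ∀ᵐ x ∂μ, ‖x‖ ≤ B) (hδ : 0 ≤ δ) :
    δ / 2 * ‖∫ x, x ∂μ‖ ^ 2 ≤ mixtureEntropy μ δ := by
  set m := ∫ x, x ∂μ with hm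
  obtain ⟨h1, h2⟩ := integral_mixtureDensity_mul_log_shiftDensity hB hδ m
  have h3 := integrable_mixtureDensity hB hδ
  have h4 := integral_mono ((h1.add h3).sub (integrable_shiftDensity hδ m))
    (integrable_mixtureDensity_mul_log hB hδ)
    (fun b => mul_log_ge (g := ⟪m, b⟫ - δ * ‖m‖ ^ 2 / 2) (mixtureDensity_pos hB hδ b))
  rw [integral_sub' (h1.add h3) (integrable_shiftDensity hδ m), integral_add' h1 h3, h2,
    integral_mixtureDensity hB hδ, integral_shiftDensity hδ, ← hm, real_inner_self_eq_norm_sq] at h4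
  rw [mixtureEntropy]
  linarith

/-- Completing the square: the integral over b of the left side is then exp(δ⟪x - m, y - m⟫). -/
lemma shiftDensity_mul_shiftDensity_div (δ : ℝ) (x y m b : EuclideanSpace ℝ (Fin n)) :
    shiftDensity δ x b * shiftDensity δ y b * Real.exp (-(⟪m, b⟫ - δ * ‖m‖ ^ 2 / 2)) =
      shiftDensity δ (x + y - m) b * Real.exp (δ * ⟪x - m, y - m⟫) := by
  simp only [shiftDensity, ← Real.exp_add]
  congr 1
  rw [← real_inner_self_eq_norm_sq (x + y - m), ← real_inner_self_eq_norm_sq x,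
    ← real_inner_self_eq_norm_sq y, ← real_inner_self_eq_norm_sq m]
  simp only [inner_sub_left, inner_add_left, inner_sub_right, inner_add_right]
  rw [real_inner_comm x y, real_inner_comm m x, real_inner_comm m y]
  ring

/-- Since |δ⟪x - m, y - m⟫| ≤ 4R²δ ≤ 1, the bound e^z ≤ 1 + z + z² applies. For independent x, y the
linear term integrates to zero, and Cauchy-Schwarz bounds the quadratic one. -/
lemma integral_exp_inner_le {B R δ : ℝ} {c : EuclideanSpace ℝ (Fin n)}
    (hB : ∀ᵐ x ∂μ, ‖x‖ ≤ B) (hR : ∀ᵐ x ∂μ, ‖x - c‖ ≤ R) (hδ : 0 ≤ δ) (hδR : δ * (4 * R ^ 2) ≤ 1) :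
    ∫ p, Real.exp (δ * ⟪p.1 - ∫ x, x ∂μ, p.2 - ∫ x, x ∂μ⟫) ∂(μ.prod μ) ≤
      1 + δ ^ 2 * totalVariance μ ^ 2 := by
  set m := ∫ x, x ∂μ with hm
  have hx : Integrable (fun x => x) μ := integrable_of_continuous_of_ae_norm_le hB continuous_id
  have hxm : Integrable (fun x => x - m) μ := hx.sub (integrable_const m)
  have hB2 : ∀ᵐ p ∂(μ.prod μ), ‖p‖ ≤ B := by
    filter_upwards [Measure.quasiMeasurePreserving_fst.ae hB,
      Measure.quasiMeasurePreserving_snd.ae hB] with p h1 h2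
    exact max_le h1 h2
  have hle := norm_sub_mean_le hB hR
  have hint : ∀ {f : EuclideanSpace ℝ (Fin n) × EuclideanSpace ℝ (Fin n) → ℝ}, Continuous f →
      Integrable f (μ.prod μ) := fun hf => integrable_of_continuous_of_ae_norm_le hB2 hf
  have h0 : ∫ p, ⟪p.1 - m, p.2 - m⟫ ∂(μ.prod μ) = 0 := by
    rw [integral_prod _ (hint (by fun_prop))]
    refine integral_eq_zero_of_ae (ae_of_all _ fun x => ?_)
    simp only [Pi.zero_apply]
    rw [integral_inner hxm, integral_sub hx (integrable_const m)]
    simp [← hm]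
  calc _ ≤ ∫ p, (1 + δ * ⟪p.1 - m, p.2 - m⟫ + δ ^ 2 * (‖p.1 - m‖ ^ 2 * ‖p.2 - m‖ ^ 2))
        ∂(μ.prod μ) := by
        refine integral_mono_ae (hint (by fun_prop)) (hint (by fun_prop)) ?_
        filter_upwards [Measure.quasiMeasurePreserving_fst.ae hle,
          Measure.quasiMeasurePreserving_snd.ae hle] with p h1 h2
        have h3 := abs_real_inner_le_norm (p.1 - m) (p.2 - m)
        have h4 : ‖p.1 - m‖ * ‖p.2 - m‖ ≤ 4 * R ^ 2 := by
          calc _ ≤ (2 * R) * (2 * R) := mul_le_mul h1 h2 (norm_nonneg _)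
                ((norm_nonneg _).trans h1)
            _ = _ := by ring
        have h5 : |δ * ⟪p.1 - m, p.2 - m⟫| ≤ 1 := by
          rw [abs_mul, abs_of_nonneg hδ]
          exact (mul_le_mul_of_nonneg_left (h3.trans h4) hδ).trans hδR
        have h6 := (abs_le.1 (Real.abs_exp_sub_one_sub_id_le h5)).2
        have h7 : (δ * ⟪p.1 - m, p.2 - m⟫) ^ 2 ≤ δ ^ 2 * (‖p.1 - m‖ ^ 2 * ‖p.2 - m‖ ^ 2) := by
          rw [mul_pow, ← mul_pow (‖p.1 - m‖), ← sq_abs ⟪p.1 - m, p.2 - m⟫]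
          gcongr
        linarith
    _ = _ := by
        rw [integral_add (hint (by fun_prop)) (hint (by fun_prop)),
          integral_add (hint (by fun_prop)) (hint (by fun_prop)), integral_const_mul, h0,
          integral_const_mul, integral_prod_mul (fun x => ‖x - m‖ ^ 2) (fun x => ‖x - m‖ ^ 2)]
        simp only [integral_const, probReal_univ, totalVariance, ← hm, smul_eq_mul]
        ring

/-- Chi-square bound against N(δm, δI). The squared mixture density is an integral over two
independent copies of μ, so Fubini reduces it to `integral_exp_inner_le`. -/
lemma mixtureEntropy_le {B R δ : ℝ} {c : EuclideanSpace ℝ (Fin n)}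
    (hB : ∀ᵐ x ∂μ, ‖x‖ ≤ B) (hR : ∀ᵐ x ∂μ, ‖x - c‖ ≤ R) (hδ : 0 ≤ δ) (hδR : δ * (4 * R ^ 2) ≤ 1) :
    mixtureEntropy μ δ ≤ δ / 2 * ‖∫ x, x ∂μ‖ ^ 2 + δ ^ 2 * totalVariance μ ^ 2 := by
  have hexp := integral_exp_inner_le hB hR hδ hδR
  set m := ∫ x, x ∂μ with hm
  obtain ⟨h1, h2⟩ := integral_mixtureDensity_mul_log_shiftDensity hB hδ m
  have h3 := integrable_mixtureDensity hB hδ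
  have hB2 : ∀ᵐ p ∂(μ.prod μ), ‖p.1‖ ≤ B ∧ ‖p.2‖ ≤ B := by
    filter_upwards [Measure.quasiMeasurePreserving_fst.ae hB,
      Measure.quasiMeasurePreserving_snd.ae hB] with p h1 h2 using ⟨h1, h2⟩
  have hsq : ∀ b, mixtureDensity μ δ b ^ 2 * Real.exp (-(⟪m, b⟫ - δ * ‖m‖ ^ 2 / 2)) =
      ∫ p, shiftDensity δ (p.1 + p.2 - m) b * Real.exp (δ * ⟪p.1 - m, p.2 - m⟫) ∂(μ.prod μ) := by
    intro b
    simp_rw [← shiftDensity_mul_shiftDensity_div]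
    rw [integral_mul_const, integral_prod_mul (fun x => shiftDensity δ x b)
      (fun x => shiftDensity δ x b), sq, mixtureDensity]
  have hB0 := nonneg_of_ae_norm_le hB
  have hprod : Integrable (fun q : (EuclideanSpace ℝ (Fin n) × EuclideanSpace ℝ (Fin n)) ×
      EuclideanSpace ℝ (Fin n) =>
        shiftDensity δ (q.1.1 + q.1.2 - m) q.2 * Real.exp (δ * ⟪q.1.1 - m, q.1.2 - m⟫))
      ((μ.prod μ).prod (isotropicGaussian n δ)) := by
    refine integrable_prod_of_norm_le_exp (A := 2 * B + ‖m‖)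
      (C := Real.exp (δ * ((B + ‖m‖) * (B + ‖m‖)))) ?_ ?_
    · refine Continuous.aestronglyMeasurable ?_
      unfold shiftDensity
      fun_prop
    · filter_upwards [hB2] with p hp b
      rw [abs_of_pos (mul_pos (shiftDensity_pos _ _ _) (Real.exp_pos _)), mul_comm]
      refine mul_le_mul ?_ (shiftDensity_le hδ ?_ b) (shiftDensity_pos _ _ _).le (Real.exp_pos _).le
      · rw [Real.exp_le_exp]
        refine mul_le_mul_of_nonneg_left ((real_inner_le_norm _ _).trans ?_) hδ
        exact mul_le_mul ((norm_sub_le _ _).trans (by gcongr; exact hp.1))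
          ((norm_sub_le _ _).trans (by gcongr; exact hp.2)) (norm_nonneg _) (by positivity)
      · calc ‖p.1 + p.2 - m‖ ≤ ‖p.1‖ + ‖p.2‖ + ‖m‖ :=
              (norm_sub_le _ _).trans (by gcongr; exact norm_add_le _ _)
          _ ≤ 2 * B + ‖m‖ := by linarith [hp.1, hp.2]
  have h5 : Integrable (fun b => mixtureDensity μ δ b ^ 2 *
      Real.exp (-(⟪m, b⟫ - δ * ‖m‖ ^ 2 / 2))) (isotropicGaussian n δ) := by
    simp_rw [hsq]
    exact hprod.integral_prod_right
  have h6 : ∫ b, mixtureDensity μ δ b ^ 2 * Real.exp (-(⟪m, b⟫ - δ * ‖m‖ ^ 2 / 2))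
      ∂(isotropicGaussian n δ) = ∫ p, Real.exp (δ * ⟪p.1 - m, p.2 - m⟫) ∂(μ.prod μ) := by
    simp_rw [hsq]
    rw [← integral_integral_swap hprod]
    simp_rw [integral_mul_const, integral_shiftDensity hδ, one_mul]
  have h4 := integral_mono (integrable_mixtureDensity_mul_log hB hδ) ((h1.add h5).sub h3)
    (fun b => mul_log_le (g := ⟪m, b⟫ - δ * ‖m‖ ^ 2 / 2) (mixtureDensity_pos hB hδ b))
  rw [integral_sub' (h1.add h5) h3, integral_add' h1 h5, h2, h6,
    integral_mixtureDensity hB hδ, ← hm, real_inner_self_eq_norm_sq] at h4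
  rw [mixtureEntropy]
  linarith

end Mixture

/-! ### Posteriors, the chain rule, and increments of the channel information -/

section Posterior

variable {n : ℕ}

/-- The conditional law of `X ∼ μ` given that `s X + √s Z = b`, where `Z ∼ N(0, I)` is independent
of `X`. -/
noncomputable def gaussianPosterior (μ : Measure (EuclideanSpace ℝ (Fin n))) (s : ℝ)
    (b : EuclideanSpace ℝ (Fin n)) : Measure (EuclideanSpace ℝ (Fin n)) :=
  μ.tilted (fun x => ⟪x, b⟫ - s * ‖x‖ ^ 2 / 2)

lemma ae_posterior {μ : Measure (EuclideanSpace ℝ (Fin n))} {p : EuclideanSpace ℝ (Fin n) → Prop}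
    (h : ∀ᵐ x ∂μ, p x) (s : ℝ) (b : EuclideanSpace ℝ (Fin n)) : ∀ᵐ x ∂(gaussianPosterior μ s b), p x :=
  (tilted_absolutelyContinuous μ _).ae_le h

lemma integral_posterior {F : Type*} [NormedAddCommGroup F] [NormedSpace ℝ F]
    (μ : Measure (EuclideanSpace ℝ (Fin n))) (s : ℝ) (b : EuclideanSpace ℝ (Fin n))
    (g : EuclideanSpace ℝ (Fin n) → F) :
    ∫ x, g x ∂(gaussianPosterior μ s b) = (mixtureDensity μ s b)⁻¹ • ∫ x, shiftDensity s x b • g x ∂μ := by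
  rw [gaussianPosterior, integral_tilted, ← integral_smul]
  refine integral_congr_ae (ae_of_all _ fun x => ?_)
  simp only
  rw [smul_smul, div_eq_inv_mul]
  rfl

/-- Log-likelihoods are linear in (s, b), so independent observations combine by adding levels and
outputs. This is the reason for scaling the channel as s x + √s Z. -/
lemma shiftDensity_mul_shiftDensity (s δ : ℝ) (x b β : EuclideanSpace ℝ (Fin n)) :
    shiftDensity s x b * shiftDensity δ x β = shiftDensity (s + δ) x (b + β) := by
  rw [shiftDensity, shiftDensity, shiftDensity, ← Real.exp_add, inner_add_right]
  ring_nf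

variable {μ : Measure (EuclideanSpace ℝ (Fin n))} [IsProbabilityMeasure μ]

lemma isProbabilityMeasure_posterior {B : ℝ} (hB : ∀ᵐ x ∂μ, ‖x‖ ≤ B) (s : ℝ)
    (b : EuclideanSpace ℝ (Fin n)) : IsProbabilityMeasure (gaussianPosterior μ s b) :=
  isProbabilityMeasure_tilted
    (integrable_of_continuous_of_ae_norm_le hB (continuous_shiftDensity_left s b))

/-- Bayes' rule: the evidence for both observations factors, the normalising constant of the
posterior cancelling. -/
lemma mixtureDensity_mul_mixtureDensity_posterior {B s : ℝ} (hB : ∀ᵐ x ∂μ, ‖x‖ ≤ B) (hs : 0 ≤ s)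
    (δ : ℝ) (b β : EuclideanSpace ℝ (Fin n)) :
    mixtureDensity μ s b * mixtureDensity (gaussianPosterior μ s b) δ β =
      mixtureDensity μ (s + δ) (b + β) := by
  rw [mixtureDensity.eq_1 (gaussianPosterior μ s b), integral_posterior, smul_eq_mul,
    mul_inv_cancel_left₀ (mixtureDensity_pos hB hs b).ne']
  simp_rw [smul_eq_mul, shiftDensity_mul_shiftDensity]
  rfl

lemma measurable_mean_posterior (s : ℝ) :
    Measurable (fun b => ∫ x, x ∂(gaussianPosterior μ s b)) := by
  simp_rw [integral_posterior]
  have h : StronglyMeasurable (fun p : EuclideanSpace ℝ (Fin n) × EuclideanSpace ℝ (Fin n) =>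
      shiftDensity s p.1 p.2 • p.1) :=
    ((continuous_shiftDensity s).smul continuous_fst).stronglyMeasurable
  exact (measurable_mixtureDensity s).inv.smul h.integral_prod_left'.measurable

lemma measurable_integral_norm_sq_posterior (s : ℝ) :
    Measurable (fun b => ∫ x, ‖x‖ ^ 2 ∂(gaussianPosterior μ s b)) := by
  simp_rw [integral_posterior]
  have h : StronglyMeasurable (fun p : EuclideanSpace ℝ (Fin n) × EuclideanSpace ℝ (Fin n) =>
      shiftDensity s p.1 p.2 • ‖p.1‖ ^ 2) :=
    ((continuous_shiftDensity s).smul (by fun_prop)).stronglyMeasurable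
  exact (measurable_mixtureDensity s).inv.smul h.integral_prod_left'.measurable

lemma integral_norm_sq_posterior {B : ℝ} (hB : ∀ᵐ x ∂μ, ‖x‖ ≤ B) (s : ℝ)
    (b : EuclideanSpace ℝ (Fin n)) :
    ∫ x, ‖x‖ ^ 2 ∂(gaussianPosterior μ s b) =
      totalVariance (gaussianPosterior μ s b) + ‖∫ x, x ∂(gaussianPosterior μ s b)‖ ^ 2 := by
  have := isProbabilityMeasure_posterior hB s b
  simpa using integral_norm_sub_sq (ae_posterior hB s b) 0

lemma integrable_mixtureDensity_mul {B s C : ℝ} (hB : ∀ᵐ x ∂μ, ‖x‖ ≤ B) (hs : 0 ≤ s)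
    {f : EuclideanSpace ℝ (Fin n) → ℝ} (hf : Measurable f) (hC : ∀ b, |f b| ≤ C) :
    Integrable (fun b => mixtureDensity μ s b * f b) (isotropicGaussian n s) := by
  refine integrable_of_abs_le_exp (C := C) (A := B)
    ((measurable_mixtureDensity s).mul hf).aestronglyMeasurable fun b => ?_
  rw [abs_mul, abs_of_pos (mixtureDensity_pos hB hs b), mul_comm]
  exact mul_le_mul (hC b) (mixtureDensity_le hB hs b) (mixtureDensity_pos hB hs b).le
    ((abs_nonneg _).trans (hC b))

lemma integrable_mixtureDensity_mul_norm_mean_sq {B s : ℝ} (hB : ∀ᵐ x ∂μ, ‖x‖ ≤ B) (hs : 0 ≤ s) :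
    Integrable (fun b => mixtureDensity μ s b * ‖∫ x, x ∂(gaussianPosterior μ s b)‖ ^ 2)
      (isotropicGaussian n s) := by
  refine integrable_mixtureDensity_mul (C := B ^ 2) hB hs
    ((measurable_mean_posterior s).norm.pow_const 2) fun b => ?_
  have := isProbabilityMeasure_posterior hB s b
  have h := norm_integral_le_of_norm_le_const (ae_posterior hB s b)
  rw [probReal_univ, mul_one] at h
  rw [abs_of_nonneg (by positivity)]
  gcongr

lemma integrable_mixtureDensity_mul_totalVariance {B s : ℝ} (hB : ∀ᵐ x ∂μ, ‖x‖ ≤ B)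
    (hs : 0 ≤ s) :
    Integrable (fun b => mixtureDensity μ s b * totalVariance (gaussianPosterior μ s b))
      (isotropicGaussian n s) := by
  refine integrable_mixtureDensity_mul (C := B ^ 2) hB hs ?_ fun b => ?_
  · have h : (fun b => totalVariance (gaussianPosterior μ s b)) = fun b =>
        ∫ x, ‖x‖ ^ 2 ∂(gaussianPosterior μ s b) - ‖∫ x, x ∂(gaussianPosterior μ s b)‖ ^ 2 := by
      ext b
      rw [integral_norm_sq_posterior hB, add_sub_cancel_right]
    rw [h]
    exact (measurable_integral_norm_sq_posterior s).sub
      ((measurable_mean_posterior s).norm.pow_const 2)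
  · have := isProbabilityMeasure_posterior hB s b
    rw [abs_of_nonneg (totalVariance_nonneg _)]
    exact totalVariance_le (c := 0) (ae_posterior hB s b) (by simpa using ae_posterior hB s b)

/-- The minimal mean square error in the estimation of `X ∼ μ` from `s X + √s Z`. -/
noncomputable def mmse (μ : Measure (EuclideanSpace ℝ (Fin n))) (s : ℝ) : ℝ :=
  ∫ b, mixtureDensity μ s b * totalVariance (gaussianPosterior μ s b) ∂(isotropicGaussian n s)

/-- Law of total variance, about the origin. -/
lemma integral_norm_sq_eq_mmse_add {B s : ℝ} (hB : ∀ᵐ x ∂μ, ‖x‖ ≤ B) (hs : 0 ≤ s) :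
    ∫ x, ‖x‖ ^ 2 ∂μ = mmse μ s +
      ∫ b, mixtureDensity μ s b * ‖∫ x, x ∂(gaussianPosterior μ s b)‖ ^ 2 ∂(isotropicGaussian n s) := by
  have h := integral_integral_shiftDensity_mul (A := 0) (C := B ^ 2) hB hs
    (f := fun x _ => ‖x‖ ^ 2) (by fun_prop) (by
      filter_upwards [hB] with x hx b
      rw [abs_of_nonneg (by positivity), zero_mul, Real.exp_zero, mul_one]
      gcongr)
  simp only [integral_mul_const, integral_shiftDensity hs, one_mul] at h
  rw [← h, mmse, ← integral_add (integrable_mixtureDensity_mul_totalVariance hB hs)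
    (integrable_mixtureDensity_mul_norm_mean_sq hB hs)]
  refine integral_congr_ae (ae_of_all _ fun b => ?_)
  simp only
  rw [← mul_add, ← integral_norm_sq_posterior hB, integral_posterior, smul_eq_mul,
    mul_inv_cancel_left₀ (mixtureDensity_pos hB hs b).ne']
  rfl

/-- The chain rule for the mixture entropy. -/
lemma mixtureEntropy_add {B s δ : ℝ} (hB : ∀ᵐ x ∂μ, ‖x‖ ≤ B) (hs : 0 ≤ s) (hδ : 0 ≤ δ) :
    Integrable (fun b => mixtureDensity μ s b * mixtureEntropy (gaussianPosterior μ s b) δ)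
      (isotropicGaussian n s) ∧
    mixtureEntropy μ (s + δ) = mixtureEntropy μ s +
      ∫ b, mixtureDensity μ s b * mixtureEntropy (gaussianPosterior μ s b) δ ∂(isotropicGaussian n s) := by
  have hi := integrable_mixtureDensity_mul_log hB (add_nonneg hs hδ)
  -- The noise at level s + δ is split into independent parts b and β of levels s and δ.
  rw [← isotropicGaussian_map_add hs hδ] at hi
  have hi2 := (integrable_map_measure hi.aestronglyMeasurable (by fun_prop)).1 hi
  simp only [Function.comp_def] at hi2
  have hK := integral_map (by fun_prop) hi.aestronglyMeasurable
  rw [isotropicGaussian_map_add hs hδ, integral_prod _ hi2] at hK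
  have key : ∀ b, ∫ β, mixtureDensity μ (s + δ) (b + β) * Real.log (mixtureDensity μ (s + δ) (b + β))
      ∂(isotropicGaussian n δ) = mixtureDensity μ s b * Real.log (mixtureDensity μ s b) +
        mixtureDensity μ s b * mixtureEntropy (gaussianPosterior μ s b) δ := by
    intro b
    have := isProbabilityMeasure_posterior hB s b
    have hB' := ae_posterior hB s b
    have hL := mixtureDensity_pos hB hs b
    have e : ∀ β, mixtureDensity μ (s + δ) (b + β) *
        Real.log (mixtureDensity μ (s + δ) (b + β)) =
        (mixtureDensity μ s b * Real.log (mixtureDensity μ s b)) *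
          mixtureDensity (gaussianPosterior μ s b) δ β +
        mixtureDensity μ s b * (mixtureDensity (gaussianPosterior μ s b) δ β *
          Real.log (mixtureDensity (gaussianPosterior μ s b) δ β)) := by
      intro β
      rw [← mixtureDensity_mul_mixtureDensity_posterior hB hs,
        Real.log_mul hL.ne' (mixtureDensity_pos hB' hδ β).ne']
      ring
    simp_rw [e]
    rw [integral_add ((integrable_mixtureDensity hB' hδ).const_mul _)
      ((integrable_mixtureDensity_mul_log hB' hδ).const_mul _), integral_const_mul,
      integral_const_mul, integral_mixtureDensity hB' hδ, mul_one]
    rfl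
  have h1 := integrable_mixtureDensity_mul_log hB hs
  have h2 := hi2.integral_prod_left
  simp only [key] at h2 hK
  have h3 : Integrable (fun b => mixtureDensity μ s b * mixtureEntropy (gaussianPosterior μ s b) δ)
      (isotropicGaussian n s) := 
    (h2.sub h1).congr (ae_of_all _ fun b => by simp)
  refine ⟨h3, ?_⟩
  rw [integral_add h1 h3] at hK
  exact hK

/-- The mutual information of `X ∼ μ` and `s X + √s Z`, where `Z ∼ N(0, I)` is independent of `X`. -/
noncomputable def channelInformation (μ : Measure (EuclideanSpace ℝ (Fin n))) (s : ℝ) : ℝ :=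
  s / 2 * ∫ x, ‖x‖ ^ 2 ∂μ - mixtureEntropy μ s

/-- The chain rule with `le_mixtureEntropy` for each posterior; the second moment minus the mean
squared posterior mean is the `mmse`. -/
lemma channelInformation_add_le {B s δ : ℝ} (hB : ∀ᵐ x ∂μ, ‖x‖ ≤ B) (hs : 0 ≤ s) (hδ : 0 ≤ δ) :
    channelInformation μ (s + δ) ≤ channelInformation μ s + δ / 2 * mmse μ s := by
  obtain ⟨h1, h2⟩ := mixtureEntropy_add hB hs hδ
  have h3 := integral_norm_sq_eq_mmse_add hB hs
  have h4 : ∫ b, δ / 2 * (mixtureDensity μ s b * ‖∫ x, x ∂(gaussianPosterior μ s b)‖ ^ 2)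
      ∂(isotropicGaussian n s) ≤
      ∫ b, mixtureDensity μ s b * mixtureEntropy (gaussianPosterior μ s b) δ ∂(isotropicGaussian n s) := by
    refine integral_mono ((integrable_mixtureDensity_mul_norm_mean_sq hB hs).const_mul _) h1
      fun b => ?_
    have := isProbabilityMeasure_posterior hB s b
    have h := mul_le_mul_of_nonneg_left (le_mixtureEntropy (ae_posterior hB s b) hδ)
      (mixtureDensity_pos hB hs b).le
    simp only
    linarith
  rw [integral_const_mul] at h4
  rw [channelInformation, channelInformation, h2, h3]
  linarith

/-- The error δ²V² of `mixtureEntropy_le` is at most R²δ²V, as each posterior has variance V ≤ R².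
It is thus proportional to `mmse`, which makes a multiplicative decay bound possible. -/
lemma le_channelInformation_add {B R s δ : ℝ} {c : EuclideanSpace ℝ (Fin n)}
    (hB : ∀ᵐ x ∂μ, ‖x‖ ≤ B) (hR : ∀ᵐ x ∂μ, ‖x - c‖ ≤ R) (hs : 0 ≤ s) (hδ : 0 ≤ δ)
    (hδR : δ * (4 * R ^ 2) ≤ 1) :
    channelInformation μ s + (δ / 2 - R ^ 2 * δ ^ 2) * mmse μ s ≤ channelInformation μ (s + δ) := by
  obtain ⟨h1, h2⟩ := mixtureEntropy_add hB hs hδ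
  have h3 := integral_norm_sq_eq_mmse_add hB hs
  have i1 := (integrable_mixtureDensity_mul_norm_mean_sq hB hs).const_mul (δ / 2)
  have i2 := (integrable_mixtureDensity_mul_totalVariance hB hs).const_mul (R ^ 2 * δ ^ 2)
  have h4 : ∫ b, mixtureDensity μ s b * mixtureEntropy (gaussianPosterior μ s b) δ
      ∂(isotropicGaussian n s) ≤
      ∫ b, (δ / 2 * (mixtureDensity μ s b * ‖∫ x, x ∂(gaussianPosterior μ s b)‖ ^ 2) +
        R ^ 2 * δ ^ 2 * (mixtureDensity μ s b * totalVariance (gaussianPosterior μ s b)))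
        ∂(isotropicGaussian n s) := by
    refine integral_mono h1 (i1.add i2) fun b => ?_
    have := isProbabilityMeasure_posterior hB s b
    have hv := totalVariance_le (ae_posterior hB s b) (ae_posterior hR s b)
    have hv2 : totalVariance (gaussianPosterior μ s b) ^ 2 ≤ R ^ 2 * totalVariance (gaussianPosterior μ s b) := by
      rw [sq]
      exact mul_le_mul_of_nonneg_right hv (totalVariance_nonneg _)
    have h5 := mul_le_mul_of_nonneg_left hv2 (sq_nonneg δ)
    have h := mul_le_mul_of_nonneg_left ((mixtureEntropy_le (ae_posterior hB s b)
      (ae_posterior hR s b) hδ hδR).trans (add_le_add_right h5 _)) (mixtureDensity_pos hB hs b).le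
    simp only
    linarith
  rw [integral_add i1 i2, integral_const_mul, integral_const_mul] at h4
  rw [channelInformation, channelInformation, h2, h3, mmse]
  rw [mmse] at h3
  linarith

lemma mmse_nonneg {B s : ℝ} (hB : ∀ᵐ x ∂μ, ‖x‖ ≤ B) (hs : 0 ≤ s) : 0 ≤ mmse μ s :=
  integral_nonneg fun b => mul_nonneg (mixtureDensity_pos hB hs b).le (totalVariance_nonneg _)

end Posterior

/-! ### Mutual information of the Gaussian channel as a Kullback-Leibler divergence -/

section Channel

variable {n : ℕ}

lemma map_prod_isotropicGaussian_eq_withDensity (μ : Measure (EuclideanSpace ℝ (Fin n)))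
    [IsProbabilityMeasure μ] {s : ℝ} (hs : 0 ≤ s) :
    (μ.prod (isotropicGaussian n s)).map (fun p => (p.1, s • p.1 + p.2)) =
      (μ.prod (isotropicGaussian n s)).withDensity
        (fun p => ENNReal.ofReal (shiftDensity s p.1 p.2)) := by
  have hm : Measurable (fun p : EuclideanSpace ℝ (Fin n) × EuclideanSpace ℝ (Fin n) =>
      ENNReal.ofReal (shiftDensity s p.1 p.2)) := (continuous_shiftDensity s).measurable.ennreal_ofReal
  refine Measure.ext_of_lintegral _ fun f hf => ?_
  rw [lintegral_map hf (by fun_prop), lintegral_withDensity_eq_lintegral_mul _ hm hf,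
    lintegral_prod _ (by fun_prop), lintegral_prod _ (hm.mul hf).aemeasurable]
  refine lintegral_congr fun x => ?_
  have h : Measurable (fun b => f (x, b)) := by fun_prop
  have hx : Measurable (fun b => ENNReal.ofReal (shiftDensity s x b)) :=
    (continuous_shiftDensity_right s x).measurable.ennreal_ofReal
  simp only [Pi.mul_apply]
  rw [← lintegral_map (f := fun b => f (x, b)) h (by fun_prop : Measurable fun z => s • x + z),
    ← withDensity_shiftDensity hs, lintegral_withDensity_eq_lintegral_mul _ hx h]
  rfl

variable {μ : Measure (EuclideanSpace ℝ (Fin n))} [IsProbabilityMeasure μ]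

lemma map_snd_withDensity_shiftDensity {B s : ℝ} (hB : ∀ᵐ x ∂μ, ‖x‖ ≤ B) :
    ((μ.prod (isotropicGaussian n s)).withDensity
        (fun p => ENNReal.ofReal (shiftDensity s p.1 p.2))).map Prod.snd =
      (isotropicGaussian n s).withDensity (fun b => ENNReal.ofReal (mixtureDensity μ s b)) := by
  have hm : Measurable (fun p : EuclideanSpace ℝ (Fin n) × EuclideanSpace ℝ (Fin n) =>
      ENNReal.ofReal (shiftDensity s p.1 p.2)) := (continuous_shiftDensity s).measurable.ennreal_ofReal
  refine Measure.ext_of_lintegral _ fun f hf => ?_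
  rw [lintegral_map hf measurable_snd, lintegral_withDensity_eq_lintegral_mul _ hm (by fun_prop),
    lintegral_withDensity_eq_lintegral_mul _ (measurable_mixtureDensity s).ennreal_ofReal hf,
    lintegral_prod_symm _ (hm.mul (by fun_prop)).aemeasurable]
  refine lintegral_congr fun b => ?_
  simp only [Pi.mul_apply]
  rw [lintegral_mul_const _ (continuous_shiftDensity_left s b).measurable.ennreal_ofReal,
    mixtureDensity,
    ofReal_integral_eq_lintegral_ofReal
      (integrable_of_continuous_of_ae_norm_le hB (continuous_shiftDensity_left s b))
      (ae_of_all _ fun x => (shiftDensity_pos s x b).le)]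

lemma integral_prod_shiftDensity_mul_log {B s : ℝ} (hB : ∀ᵐ x ∂μ, ‖x‖ ≤ B) (hs : 0 ≤ s) :
    Integrable (fun p : EuclideanSpace ℝ (Fin n) × EuclideanSpace ℝ (Fin n) =>
      shiftDensity s p.1 p.2 * Real.log (shiftDensity s p.1 p.2 / mixtureDensity μ s p.2))
      (μ.prod (isotropicGaussian n s)) ∧
    ∫ p, shiftDensity s p.1 p.2 * Real.log (shiftDensity s p.1 p.2 / mixtureDensity μ s p.2)
      ∂(μ.prod (isotropicGaussian n s)) = channelInformation μ s := by
  have hB0 := nonneg_of_ae_norm_le hB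
  have h1 : Integrable (fun p : EuclideanSpace ℝ (Fin n) × EuclideanSpace ℝ (Fin n) =>
      shiftDensity s p.1 p.2 * (⟪p.1, p.2⟫ - s * ‖p.1‖ ^ 2 / 2))
      (μ.prod (isotropicGaussian n s)) := by
    refine integrable_prod_of_norm_le_exp (A := 2 * B) (C := Real.exp (s * B ^ 2 / 2))
      ((continuous_shiftDensity s).mul (by fun_prop)).aestronglyMeasurable ?_
    filter_upwards [hB] with x hx b
    have e1 : |⟪x, b⟫ - s * ‖x‖ ^ 2 / 2| ≤ Real.exp (B * ‖b‖ + s * B ^ 2 / 2) := by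
      refine le_trans ?_ ((lt_add_one _).le.trans (Real.add_one_le_exp _))
      refine (abs_sub _ _).trans ?_
      rw [abs_of_nonneg (by positivity : 0 ≤ s * ‖x‖ ^ 2 / 2)]
      refine add_le_add ((abs_real_inner_le_norm x b).trans ?_) ?_ <;> gcongr
    rw [abs_mul, abs_of_pos (shiftDensity_pos s x b)]
    calc _ ≤ Real.exp (B * ‖b‖) * Real.exp (B * ‖b‖ + s * B ^ 2 / 2) :=
          mul_le_mul (shiftDensity_le hs hx b) e1 (abs_nonneg _) (Real.exp_pos _).le
      _ = _ := by
          rw [← Real.exp_add, ← Real.exp_add]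
          ring_nf
  have h2 : Integrable (fun p : EuclideanSpace ℝ (Fin n) × EuclideanSpace ℝ (Fin n) =>
      shiftDensity s p.1 p.2 * Real.log (mixtureDensity μ s p.2))
      (μ.prod (isotropicGaussian n s)) := by
    refine integrable_prod_of_norm_le_exp (A := 2 * B) (C := Real.exp (s * B ^ 2 / 2))
      ((continuous_shiftDensity s).measurable.mul
        ((measurable_mixtureDensity s).comp measurable_snd).log).aestronglyMeasurable ?_
    filter_upwards [hB] with x hx b
    have e1 : |Real.log (mixtureDensity μ s b)| ≤ Real.exp (B * ‖b‖ + s * B ^ 2 / 2) :=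
      (abs_log_mixtureDensity_le hB hs b).trans
        ((lt_add_one _).le.trans (Real.add_one_le_exp _))
    rw [abs_mul, abs_of_pos (shiftDensity_pos s x b)]
    calc _ ≤ Real.exp (B * ‖b‖) * Real.exp (B * ‖b‖ + s * B ^ 2 / 2) :=
          mul_le_mul (shiftDensity_le hs hx b) e1 (abs_nonneg _) (Real.exp_pos _).le
      _ = _ := by
          rw [← Real.exp_add, ← Real.exp_add]
          ring_nf
  have e : ∀ p : EuclideanSpace ℝ (Fin n) × EuclideanSpace ℝ (Fin n),
      shiftDensity s p.1 p.2 * Real.log (shiftDensity s p.1 p.2 / mixtureDensity μ s p.2) =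
      shiftDensity s p.1 p.2 * (⟪p.1, p.2⟫ - s * ‖p.1‖ ^ 2 / 2) -
        shiftDensity s p.1 p.2 * Real.log (mixtureDensity μ s p.2) := by
    intro p
    rw [Real.log_div (shiftDensity_pos _ _ _).ne' (mixtureDensity_pos hB hs _).ne', mul_sub]
    congr 2
    rw [shiftDensity, Real.log_exp]
  simp_rw [e]
  refine ⟨h1.sub h2, ?_⟩
  rw [integral_sub h1 h2, integral_prod _ h1, integral_prod_symm _ h2, channelInformation,
    mixtureEntropy]
  congr 1
  · rw [← integral_const_mul]
    refine integral_congr_ae (ae_of_all _ fun x => ?_)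
    have i1 : Integrable (fun b => shiftDensity s x b * ⟪x, b⟫) (isotropicGaussian n s) := by
      -- A Dirac mass at x has `shiftDensity s x` as its mixture density.
      have := integrable_mixtureDensity_mul_inner (μ := Measure.dirac x) (B := ‖x‖)
        (by simp) hs x
      simpa [mixtureDensity] using this
    simp only [mul_sub]
    rw [integral_sub i1 ((integrable_shiftDensity hs x).mul_const _),
      integral_shiftDensity_mul_inner hs, integral_mul_const, integral_shiftDensity hs,
      real_inner_self_eq_norm_sq]
    ring
  · refine integral_congr_ae (ae_of_all _ fun b => ?_)
    simp only
    rw [integral_mul_const]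
    rfl

/-- The mutual information of the input and the output of the Gaussian channel. -/
lemma klDiv_gaussianChannel {B s : ℝ} (hB : ∀ᵐ x ∂μ, ‖x‖ ≤ B) (hs : 0 ≤ s)
    {J : Measure (EuclideanSpace ℝ (Fin n) × EuclideanSpace ℝ (Fin n))}
    (hJ : J = (μ.prod (isotropicGaussian n s)).map (fun p => (p.1, s • p.1 + p.2))) :
    klDiv J (μ.prod (J.map Prod.snd)) ≠ ∞ ∧
      (klDiv J (μ.prod (J.map Prod.snd))).toReal = channelInformation μ s := by
  have hprobJ : IsProbabilityMeasure J := by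
    rw [hJ]
    exact Measure.isProbabilityMeasure_map (by fun_prop)
  have hprobQ : IsProbabilityMeasure (J.map Prod.snd) :=
    Measure.isProbabilityMeasure_map (by fun_prop)
  have hq : Measurable (fun p : EuclideanSpace ℝ (Fin n) × EuclideanSpace ℝ (Fin n) =>
      shiftDensity s p.1 p.2) := (continuous_shiftDensity s).measurable
  have hL := measurable_mixtureDensity (μ := μ) s
  have hL2 : Measurable (fun p : EuclideanSpace ℝ (Fin n) × EuclideanSpace ℝ (Fin n) =>
      mixtureDensity μ s p.2) := hL.comp measurable_snd
  have hJd := hJ.trans (map_prod_isotropicGaussian_eq_withDensity μ hs)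
  have hQd : μ.prod (J.map Prod.snd) = (μ.prod (isotropicGaussian n s)).withDensity
      (fun p => ENNReal.ofReal (mixtureDensity μ s p.2)) := by
    rw [hJd, map_snd_withDensity_shiftDensity hB]
    exact prod_withDensity_right hL.ennreal_ofReal
  have hr : Measurable (fun p : EuclideanSpace ℝ (Fin n) × EuclideanSpace ℝ (Fin n) =>
      shiftDensity s p.1 p.2 / mixtureDensity μ s p.2) := hq.div hL2
  have hJQ : J = (μ.prod (J.map Prod.snd)).withDensity
      (fun p => ENNReal.ofReal (shiftDensity s p.1 p.2 / mixtureDensity μ s p.2)) := by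
    rw [hQd, ← withDensity_mul _ hL2.ennreal_ofReal hr.ennreal_ofReal, hJd]
    congr 1
    ext p
    have hpos := mixtureDensity_pos hB hs p.2
    rw [Pi.mul_apply, ← ENNReal.ofReal_mul hpos.le, mul_div_cancel₀ _ hpos.ne']
  have hac : J ≪ μ.prod (J.map Prod.snd) := by
    conv_lhs => rw [hJQ]
    exact withDensity_absolutelyContinuous _ _
  have hrn : J.rnDeriv (μ.prod (J.map Prod.snd)) =ᵐ[μ.prod (J.map Prod.snd)]
      fun p => ENNReal.ofReal (shiftDensity s p.1 p.2 / mixtureDensity μ s p.2) := by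
    have h := Measure.rnDeriv_withDensity (μ.prod (J.map Prod.snd)) hr.ennreal_ofReal
    rwa [← hJQ] at h
  have hllr : llr J (μ.prod (J.map Prod.snd)) =ᵐ[J]
      fun p => Real.log (shiftDensity s p.1 p.2 / mixtureDensity μ s p.2) := by
    filter_upwards [hac.ae_le hrn] with p hp
    rw [llr, hp, ENNReal.toReal_ofReal
      (div_nonneg (shiftDensity_pos _ _ _).le (mixtureDensity_pos hB hs _).le)]
  obtain ⟨hi, hv⟩ := integral_prod_shiftDensity_mul_log hB hs
  have hint : Integrable (llr J (μ.prod (J.map Prod.snd))) J := by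
    rw [integrable_congr hllr, hJd, integrable_withDensity_iff_integrable_smul₀'
      hq.ennreal_ofReal.aemeasurable (by simp)]
    simpa only [ENNReal.toReal_ofReal (shiftDensity_pos s _ _).le, smul_eq_mul] using hi
  refine ⟨klDiv_ne_top hac hint, ?_⟩
  -- Both measures have mass 1, so the mass correction in `klDiv` vanishes.
  rw [toReal_klDiv_of_measure_eq hac (by simp), integral_congr_ae hllr, ← hv, hJd,
    integral_withDensity_eq_integral_toReal_smul hq.ennreal_ofReal (by simp)]
  simp only [ENNReal.toReal_ofReal (shiftDensity_pos s _ _).le, smul_eq_mul]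

end Channel

/-! ### Data processing, invariance under rescaling, constant input -/

section MutualInformation

variable {Ω 𝓧 𝓨 𝓩 : Type*} [MeasurableSpace Ω] [MeasurableSpace 𝓧] [MeasurableSpace 𝓨]
  [MeasurableSpace 𝓩] {P : Measure Ω} [IsProbabilityMeasure P]

lemma mutualInformation_comp_right_le {X : Ω → 𝓧} {Y : Ω → 𝓨} {g : 𝓨 → 𝓩}
    (hX : AEMeasurable X P) (hY : AEMeasurable Y P) (hg : Measurable g) :
    mutualInformation X (fun ω => g (Y ω)) P ≤ mutualInformation X Y P := by
  have := Measure.isProbabilityMeasure_map hX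
  have := Measure.isProbabilityMeasure_map hY
  have hm : Measurable (Prod.map (id : 𝓧 → 𝓧) g) := measurable_id.prodMap hg
  have h := klDiv_map_le (P.map (fun ω => (X ω, Y ω))) ((P.map X).prod (P.map Y)) hm
  rw [AEMeasurable.map_map_of_aemeasurable hm.aemeasurable (hX.prodMk hY),
    ← Measure.map_prod_map _ _ measurable_id hg, Measure.map_id,
    AEMeasurable.map_map_of_aemeasurable hg.aemeasurable hY] at h
  exact h

lemma mutualInformation_smul_right {E : Type*} [NormedAddCommGroup E] [NormedSpace ℝ E]
    [MeasurableSpace E] [BorelSpace E] {X : Ω → 𝓧} {Y : Ω → E} (hX : AEMeasurable X P)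
    (hY : AEMeasurable Y P) {k : ℝ} (hk : k ≠ 0) :
    mutualInformation X (fun ω => k • Y ω) P = mutualInformation X Y P := by
  refine le_antisymm (mutualInformation_comp_right_le hX hY (measurable_const_smul k)) ?_
  have h := mutualInformation_comp_right_le (Y := fun ω => k • Y ω) hX (hY.const_smul k)
    (measurable_const_smul k⁻¹)
  simpa only [inv_smul_smul₀ hk] using h

lemma mutualInformation_eq_zero_of_ae_eq_const {X : Ω → 𝓧} {Y : Ω → 𝓨} {c : 𝓧}
    (hX : X =ᵐ[P] fun _ => c) (hY : AEMeasurable Y P) : mutualInformation X Y P = 0 := by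
  have := Measure.isProbabilityMeasure_map hY
  have h1 : P.map (fun ω => (X ω, Y ω)) = (Measure.dirac c).prod (P.map Y) := by
    rw [Measure.dirac_prod, AEMeasurable.map_map_of_aemeasurable (by fun_prop) hY]
    refine Measure.map_congr ?_
    filter_upwards [hX] with ω h
    rw [h]
    rfl
  have h2 : P.map X = Measure.dirac c := by
    rw [Measure.map_congr hX, Measure.map_const]
    simp
  rw [mutualInformation, h1, h2, klDiv_self]

end MutualInformation

/-! ### Reduction of the Ornstein-Uhlenbeck process to the Gaussian channel -/

section OrnsteinUhlenbeck

variable {Ω : Type*} [MeasurableSpace Ω] {P : Measure Ω} [IsProbabilityMeasure P] {n : ℕ} {α : ℝ}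
  {X : ℝ → Ω → EuclideanSpace ℝ (Fin n)}

lemma exp_mul_sub_one_pos {t : ℝ} (hα : 0 < α) (ht : 0 < t) : 0 < Real.exp (2 * α * t) - 1 :=
  sub_pos.2 (Real.one_lt_exp_iff.2 (by positivity))

lemma ouVariance_pos {t : ℝ} (hα : 0 < α) (ht : 0 < t) : 0 < ouVariance α t := by
  refine div_pos (sub_pos.2 (Real.exp_lt_one_iff.2 ?_)) hα
  have : 0 < α * t := mul_pos hα ht
  linarith

lemma exp_sq_div_ouVariance {t : ℝ} (hα : 0 < α) (ht : 0 < t) :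
    Real.exp (-α * t) ^ 2 / ouVariance α t = α / (Real.exp (2 * α * t) - 1) := by
  have h1 := exp_mul_sub_one_pos hα ht
  have h2 := ouVariance_pos hα ht
  have h3 : Real.exp (-2 * α * t) = (Real.exp (2 * α * t))⁻¹ := by
    rw [← Real.exp_neg]
    ring_nf
  have h4 : Real.exp (-α * t) ^ 2 = (Real.exp (2 * α * t))⁻¹ := by
    rw [← Real.exp_neg, ← Real.exp_nat_mul]
    push_cast
    ring_nf
  rw [div_eq_div_iff h2.ne' h1.ne', h4, ouVariance, h3]
  field_simp

lemma IsOUProcess.map_prodMk (hX : IsOUProcess α X P) {t : ℝ} (ht : 0 ≤ t) :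
    P.map (fun ω => (X 0 ω, X t ω)) =
      ((P.map (X 0)).prod (isotropicGaussian n (ouVariance α t))).map
        (fun p => (p.1, Real.exp (-α * t) • p.1 + p.2)) := by
  have h0 := hX.aemeasurable 0 le_rfl
  have hN := hX.hasLaw_noise 0 t le_rfl ht
  have hI := hX.indepFun_noise 0 t le_rfl ht
  simp only [sub_zero] at hN hI
  -- The past up to time 0 is indexed by the one-point set `Set.Icc 0 0`.
  have hI2 : IndepFun (X 0) (fun ω => X t ω - Real.exp (-α * t) • X 0 ω) P :=
    hI.comp (measurable_pi_apply (⟨0, le_rfl, le_rfl⟩ : Set.Icc (0 : ℝ) 0)) measurable_id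
  rw [← hN.map_eq, ← (indepFun_iff_map_prod_eq_prod_map_map h0 hN.aemeasurable).1 hI2,
    AEMeasurable.map_map_of_aemeasurable (by fun_prop) (h0.prodMk hN.aemeasurable)]
  congr 1
  ext1 ω
  simp

/-- Given `X 0 = x`, the law of `X t` is N(a x, τ I). Multiplying by a/τ makes shift factor and
noise variance both equal to a²/τ, the form required of the channel. -/
lemma IsOUProcess.mutualInformation_eq (hX : IsOUProcess α X P) (hα : 0 < α) {B t : ℝ}
    (hB : ∀ᵐ x ∂(P.map (X 0)), ‖x‖ ≤ B) (ht : 0 < t) :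
    mutualInformation (X 0) (X t) P ≠ ∞ ∧ (mutualInformation (X 0) (X t) P).toReal =
      channelInformation (P.map (X 0)) (α / (Real.exp (2 * α * t) - 1)) := by
  have h0 := hX.aemeasurable 0 le_rfl
  have ht' := hX.aemeasurable t ht.le
  have := Measure.isProbabilityMeasure_map h0
  have hτ := ouVariance_pos hα ht
  set τ := ouVariance α t with hτ_def
  set a := Real.exp (-α * t) with ha
  have hapos : 0 < a := Real.exp_pos _
  have hk : a / τ ≠ 0 := (div_pos hapos hτ).ne'
  rw [← exp_sq_div_ouVariance hα ht, ← mutualInformation_smul_right h0 ht' hk]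
  have hJ : P.map (fun ω => (X 0 ω, (a / τ) • X t ω)) =
      ((P.map (X 0)).prod (isotropicGaussian n (a ^ 2 / τ))).map
        (fun p => (p.1, (a ^ 2 / τ) • p.1 + p.2)) := by
    have e1 : P.map (fun ω => (X 0 ω, (a / τ) • X t ω)) =
        (P.map (fun ω => (X 0 ω, X t ω))).map (Prod.map id (fun z => (a / τ) • z)) := by
      rw [AEMeasurable.map_map_of_aemeasurable (by fun_prop) (h0.prodMk ht')]
      rfl
    have e2 : a ^ 2 / τ = (a / τ) ^ 2 * τ := by field_simp
    rw [e1, hX.map_prodMk ht.le, Measure.map_map (by fun_prop) (by fun_prop), e2,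
      ← isotropicGaussian_map_smul hτ.le]
    nth_rw 2 [← Measure.map_id (μ := P.map (X 0))]
    rw [Measure.map_prod_map _ _ measurable_id (by fun_prop),
      Measure.map_map (by fun_prop) (by fun_prop)]
    congr 1
    ext1 p
    simp only [Function.comp_apply, Prod.map, id, smul_add, smul_smul]
    congr 3
    rw [← ha, ← e2]
    ring
  have hsnd : P.map (fun ω => (a / τ) • X t ω) =
      (P.map (fun ω => (X 0 ω, (a / τ) • X t ω))).map Prod.snd := by
    rw [AEMeasurable.map_map_of_aemeasurable measurable_snd.aemeasurable
      (by fun_prop : AEMeasurable (fun ω => (X 0 ω, (a / τ) • X t ω)) P)]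
    rfl
  rw [mutualInformation, hsnd]
  exact klDiv_gaussianChannel hB (by positivity) hJ

end OrnsteinUhlenbeck

open Filter Topology

/-! ### From increment bounds to a derivative and a decay rate -/

section Increments

variable {J M : ℝ → ℝ} {R : ℝ}

/-- The lower bound over [s, s + 2δ] is set against the upper bounds over its two halves; the error
R²(2δ)² divided by δ/2 gives the constant 8R². -/
lemma mul_le_of_increments
    (hle : ∀ s δ, 0 ≤ s → 0 ≤ δ → J (s + δ) ≤ J s + δ / 2 * M s)
    (hge : ∀ s δ, 0 ≤ s → 0 ≤ δ → δ * (4 * R ^ 2) ≤ 1 →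
      J s + (δ / 2 - R ^ 2 * δ ^ 2) * M s ≤ J (s + δ))
    {s δ : ℝ} (hs : 0 ≤ s) (hδ : 0 < δ) (hδR : 8 * R ^ 2 * δ ≤ 1) :
    (1 - 8 * R ^ 2 * δ) * M s ≤ M (s + δ) := by
  have h1 := hge s (2 * δ) hs (by positivity) (by linarith)
  have h2 := hle s δ hs hδ.le
  have h3 := hle (s + δ) δ (by positivity) hδ.le
  rw [show s + δ + δ = s + 2 * δ by ring] at h3
  have h4 : δ * ((1 - 8 * R ^ 2 * δ) * M s) ≤ δ * M (s + δ) := by linarith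
  exact le_of_mul_le_mul_left h4 hδ

/-- The converse comparison: lower bounds on the halves against the upper bound on the whole. With y
= R²δ ≤ 1/8, one has 1 + 2y ≤ (1 - 2y)(1 + 8y). -/
lemma le_mul_of_increments (hM : ∀ s, 0 ≤ s → 0 ≤ M s)
    (hle : ∀ s δ, 0 ≤ s → 0 ≤ δ → J (s + δ) ≤ J s + δ / 2 * M s)
    (hge : ∀ s δ, 0 ≤ s → 0 ≤ δ → δ * (4 * R ^ 2) ≤ 1 →
      J s + (δ / 2 - R ^ 2 * δ ^ 2) * M s ≤ J (s + δ))
    {s δ : ℝ} (hs : 0 ≤ s) (hδ : 0 < δ) (hδR : 8 * R ^ 2 * δ ≤ 1) :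
    M (s + δ) ≤ (1 + 8 * R ^ 2 * δ) * M s := by
  have hy : 0 ≤ R ^ 2 * δ := by positivity
  have h1 := hge s δ hs hδ.le (by linarith)
  have h2 := hge (s + δ) δ (by positivity) hδ.le (by linarith)
  have h3 := hle s (2 * δ) hs (by positivity)
  rw [show s + δ + δ = s + 2 * δ by ring] at h2
  have h4 : δ * ((1 - 2 * (R ^ 2 * δ)) * M (s + δ)) ≤ δ * ((1 + 2 * (R ^ 2 * δ)) * M s) := by
    linarith
  have h5 := le_of_mul_le_mul_left h4 hδ
  have h6 : (1 + 2 * (R ^ 2 * δ)) * M s ≤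
      (1 - 2 * (R ^ 2 * δ)) * ((1 + 8 * R ^ 2 * δ) * M s) := by
    have : 0 ≤ (R ^ 2 * δ) * (4 - 16 * (R ^ 2 * δ)) * M s :=
      mul_nonneg (mul_nonneg hy (by linarith)) (hM s hs)
    linarith
  exact le_of_mul_le_mul_left (h5.trans h6) (by linarith)

/-- `mul_le_of_increments` is iterated over N equal steps, and (1 - x/N)^N → e^{-x}. -/
lemma le_exp_mul_of_increments
    (hle : ∀ s δ, 0 ≤ s → 0 ≤ δ → J (s + δ) ≤ J s + δ / 2 * M s)
    (hge : ∀ s δ, 0 ≤ s → 0 ≤ δ → δ * (4 * R ^ 2) ≤ 1 →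
      J s + (δ / 2 - R ^ 2 * δ ^ 2) * M s ≤ J (s + δ))
    {s r : ℝ} (hs : 0 ≤ s) (hsr : s ≤ r) :
    Real.exp (-(8 * R ^ 2 * (r - s))) * M s ≤ M r := by
  rcases hsr.eq_or_lt with rfl | hlt
  · simp
  have hd : 0 < r - s := sub_pos.2 hlt
  have hlim := (Real.tendsto_one_add_div_pow_exp (-(8 * R ^ 2 * (r - s)))).mul_const (M s)
  refine le_of_tendsto hlim ?_
  filter_upwards [eventually_ge_atTop (Nat.ceil (8 * R ^ 2 * (r - s))), eventually_gt_atTop 0]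
    with N hN hN0
  have hNpos : (0 : ℝ) < N := by exact_mod_cast hN0
  have hN' : 8 * R ^ 2 * (r - s) ≤ N := Nat.ceil_le.1 hN
  set δ := (r - s) / N with hδ_def
  have hδ : 0 < δ := by positivity
  have hδR : 8 * R ^ 2 * δ ≤ 1 := by
    rw [hδ_def, ← mul_div_assoc]
    exact (div_le_one hNpos).2 hN'
  have hbase : 1 + -(8 * R ^ 2 * (r - s)) / N = 1 - 8 * R ^ 2 * δ := by
    rw [hδ_def]
    ring
  rw [hbase]
  have hind : ∀ k : ℕ, (1 - 8 * R ^ 2 * δ) ^ k * M s ≤ M (s + k * δ) := by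
    intro k
    induction k with
    | zero => simp
    | succ k ih =>
      have h1 := mul_le_of_increments hle hge (s := s + k * δ) (by positivity) hδ hδR
      have h2 := mul_le_mul_of_nonneg_left ih (sub_nonneg.2 hδR)
      rw [pow_succ']
      push_cast
      rw [show s + (k + 1) * δ = s + k * δ + δ by ring]
      linarith
  have h := hind N
  rwa [show s + N * δ = r by rw [hδ_def]; field_simp; ring] at h

lemma hasDerivAt_of_increments (hM : ∀ s, 0 ≤ s → 0 ≤ M s)
    (hle : ∀ s δ, 0 ≤ s → 0 ≤ δ → J (s + δ) ≤ J s + δ / 2 * M s)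
    (hge : ∀ s δ, 0 ≤ s → 0 ≤ δ → δ * (4 * R ^ 2) ≤ 1 →
      J s + (δ / 2 - R ^ 2 * δ ^ 2) * M s ≤ J (s + δ))
    {s : ℝ} (hs : 0 < s) : HasDerivAt J (M s / 2) s := by
  rw [hasDerivAt_iff_isLittleO_nhds_zero]
  have hbig : (fun h => J (s + h) - J s - h • (M s / 2)) =O[𝓝 0] fun h : ℝ => h ^ 2 := by
    -- For h < 0 the bounds are based at s + h. Replacing M(s + h) by M(s) costs at most 8R²h²M(s),
    -- and the quadratic error at most 2R²h²M(s), as M(s + h) ≤ 2M(s) when 16R²|h| ≤ 1.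
    refine Asymptotics.IsBigO.of_bound (10 * R ^ 2 * M s) ?_
    have hεpos : 0 < min s (1 / (16 * R ^ 2 + 1)) := by positivity
    filter_upwards [Metric.ball_mem_nhds (0 : ℝ) hεpos] with h hh
    rw [Metric.mem_ball, dist_zero_right, Real.norm_eq_abs, lt_min_iff,
      lt_div_iff₀ (by positivity)] at hh
    obtain ⟨hh1, hh2⟩ := hh
    have hsmall : 16 * R ^ 2 * |h| ≤ 1 := by linarith [abs_nonneg h]
    have hMs := hM s hs.le
    have hnn : 0 ≤ R ^ 2 * h ^ 2 * M s := by positivity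
    rw [Real.norm_eq_abs, Real.norm_eq_abs, abs_of_nonneg (sq_nonneg h), smul_eq_mul, abs_le]
    rcases lt_trichotomy h 0 with h0 | h0 | h0
    · rw [abs_of_neg h0] at hh1 hsmall
      have hr : 0 ≤ s + h := by linarith
      have hb : 0 < -h := by linarith
      have e1 := hle (s + h) (-h) hr hb.le
      have e2 := hge (s + h) (-h) hr hb.le (by nlinarith [sq_nonneg R])
      have e3 := mul_le_of_increments hle hge hr hb (by nlinarith [sq_nonneg R])
      have e4 := le_mul_of_increments hM hle hge hr hb (by nlinarith [sq_nonneg R])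
      rw [add_neg_cancel_right] at e1 e2 e3 e4
      have hMr := hM (s + h) hr
      have e5 : M (s + h) ≤ 2 * M s := by nlinarith [sq_nonneg R]
      have e6 := mul_le_mul_of_nonneg_left e5 (by positivity : 0 ≤ R ^ 2 * h ^ 2)
      have e7 := mul_le_mul_of_nonneg_left e3 hb.le
      have e8 := mul_le_mul_of_nonneg_left e4 hb.le
      constructor <;> nlinarith
    · subst h0
      simp
    · rw [abs_of_pos h0] at hsmall
      have e1 := hle s h hs.le h0.le
      have e2 := hge s h hs.le h0.le (by nlinarith [sq_nonneg R])
      constructor <;> nlinarith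
  refine hbig.trans_isLittleO ?_
  simpa using Asymptotics.isLittleO_pow_pow (𝕜 := ℝ) one_lt_two

end Increments

/-! ### Convexity after the change of variable from signal-to-noise ratio to time -/

section TimeChange

/-- The logarithmic derivative is 1/s + 1/(s + α) - l, which decreases in s; the hypothesis is its
nonnegativity at the right endpoint b. -/
lemma monotoneOn_mul_mul_exp {α l b : ℝ} (hα : 0 < α) (hb : 0 < b)
    (h : l * b * (b + α) ≤ 2 * b + α) :
    MonotoneOn (fun s => s * (s + α) * Real.exp (-(l * s))) (Set.Icc 0 b) := by
  have hd : ∀ s : ℝ, HasDerivAt (fun s => s * (s + α) * Real.exp (-(l * s)))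
      ((2 * s + α - l * s * (s + α)) * Real.exp (-(l * s))) s := by
    intro s
    have h1 : HasDerivAt (fun s => s * (s + α)) (1 * (s + α) + s * 1) s :=
      (hasDerivAt_id s).mul ((hasDerivAt_id s).add_const α)
    have h2 : HasDerivAt (fun s => Real.exp (-(l * s))) (Real.exp (-(l * s)) * (-(l * 1))) s :=
      (((hasDerivAt_id s).const_mul l).neg).exp
    exact (h1.mul h2).congr_deriv (by ring)
  refine monotoneOn_of_deriv_nonneg (convex_Icc 0 b)
    (fun s _ => (hd s).continuousAt.continuousWithinAt)
    (fun s _ => (hd s).differentiableAt.differentiableWithinAt) fun s hs => ?_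
  rw [interior_Icc] at hs
  rw [(hd s).deriv]
  refine mul_nonneg ?_ (Real.exp_pos _).le
  have h1 : b * (l * s * (s + α)) ≤ b * (2 * s + α) := by
    rcases le_total 0 l with hl | hl
    · have h2 := mul_le_mul_of_nonneg_left h hs.1.le
      have h3 : 0 ≤ l * s * b * (b - s) :=
        mul_nonneg (mul_nonneg (mul_nonneg hl hs.1.le) hb.le) (sub_nonneg.2 hs.2.le)
      have h4 : 0 ≤ α * (b - s) := mul_nonneg hα.le (sub_nonneg.2 hs.2.le)
      nlinarith
    · have h2 : l * s * (s + α) ≤ 0 :=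
        mul_nonpos_of_nonpos_of_nonneg (mul_nonpos_of_nonpos_of_nonneg hl hs.1.le)
          (by linarith [hs.1])
      have h3 : 0 ≤ 2 * s + α := by linarith [hs.1]
      exact mul_le_mul_of_nonneg_left (h2.trans h3) hb.le
  exact sub_nonneg.2 (le_of_mul_le_mul_left h1 hb)

lemma hasDerivAt_snr {α t : ℝ} (hα : 0 < α) (ht : 0 < t) :
    HasDerivAt (fun t => α / (Real.exp (2 * α * t) - 1))
      (-(2 * (α / (Real.exp (2 * α * t) - 1)) * (α / (Real.exp (2 * α * t) - 1) + α))) t := by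
  have hpos := exp_mul_sub_one_pos hα ht
  have h1 : HasDerivAt (fun t => Real.exp (2 * α * t) - 1)
      (Real.exp (2 * α * t) * (2 * α * 1)) t :=
    (((hasDerivAt_id t).const_mul (2 * α)).exp).sub_const 1
  refine ((hasDerivAt_const t α).div h1 hpos.ne').congr_deriv ?_
  field_simp
  ring

/-- The derivative in t is -M(σ)σ(σ + α). The loss allowed by `hexp` is compensated by the growth of
s(s + α)e^{-ls}, for which `hTl` is the endpoint condition at σ(T). -/
lemma convexOn_comp_snr {J M : ℝ → ℝ} {α l T : ℝ} (hα : 0 < α) (hT : 0 < T)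
    (hJ : ∀ s, 0 < s → HasDerivAt J (M s / 2) s) (hM : ∀ s, 0 ≤ s → 0 ≤ M s)
    (hexp : ∀ s r, 0 ≤ s → s ≤ r → Real.exp (-(l * (r - s))) * M s ≤ M r)
    (hTl : l * α * Real.exp (2 * α * T) ≤ Real.exp (2 * α * T) ^ 2 - 1) :
    ConvexOn ℝ (Set.Ici T) (fun t => J (α / (Real.exp (2 * α * t) - 1))) := by
  set σ : ℝ → ℝ := fun t => α / (Real.exp (2 * α * t) - 1) with hσ
  have hσpos : ∀ t, 0 < t → 0 < σ t := fun t ht => div_pos hα (exp_mul_sub_one_pos hα ht)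
  have hσanti : ∀ t r, 0 < t → t ≤ r → σ r ≤ σ t := by
    intro t r ht htr
    have := exp_mul_sub_one_pos hα ht
    simp only [hσ]
    gcongr
  have hd : ∀ t, 0 < t → HasDerivAt (fun t => J (σ t)) (-(M (σ t) * (σ t * (σ t + α)))) t := by
    intro t ht
    exact ((hJ (σ t) (hσpos t ht)).comp t (hasDerivAt_snr hα ht)).congr_deriv (by ring)
  have hb : l * σ T * (σ T + α) ≤ 2 * σ T + α := by
    have hu := exp_mul_sub_one_pos hα hT
    simp only [hσ]
    set u := Real.exp (2 * α * T)
    have e1 : l * (α / (u - 1)) * (α / (u - 1) + α) = α * (l * α * u) / (u - 1) ^ 2 := by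
      field_simp
      ring
    have e2 : 2 * (α / (u - 1)) + α = α * (u ^ 2 - 1) / (u - 1) ^ 2 := by
      field_simp
      ring
    rw [e1, e2]
    gcongr
  have hmono := monotoneOn_mul_mul_exp hα (hσpos T hT) hb
  refine MonotoneOn.convexOn_of_deriv (convex_Ici T)
    (fun t ht => (hd t (hT.trans_le ht)).continuousAt.continuousWithinAt)
    (fun t ht => (hd t (hT.trans_le (interior_subset ht))).differentiableAt.differentiableWithinAt)
    fun t ht r hr htr => ?_
  have htT : T ≤ t := interior_subset ht
  have ht0 : 0 < t := hT.trans_le htT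
  have hr0 : 0 < r := ht0.trans_le htr
  rw [(hd t ht0).deriv, (hd r hr0).deriv, neg_le_neg_iff]
  have hrt := hσanti t r ht0 htr
  have h1 := hexp (σ r) (σ t) (hσpos r hr0).le hrt
  have h2 := hmono ⟨(hσpos r hr0).le, hσanti T r hT (htT.trans htr)⟩
    ⟨(hσpos t ht0).le, hσanti T t hT htT⟩ hrt
  simp only at h2
  have h3 : σ r * (σ r + α) ≤ σ t * (σ t + α) * Real.exp (-(l * (σ t - σ r))) := by
    have h4 := mul_le_mul_of_nonneg_right h2 (Real.exp_pos (l * σ r)).le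
    rw [mul_assoc, ← Real.exp_add, mul_assoc (σ t * (σ t + α)), ← Real.exp_add, neg_add_cancel,
      Real.exp_zero, mul_one] at h4
    rwa [show -(l * (σ t - σ r)) = -(l * σ t) + l * σ r by ring]
  calc M (σ r) * (σ r * (σ r + α))
      ≤ M (σ r) * (σ t * (σ t + α) * Real.exp (-(l * (σ t - σ r)))) :=
        mul_le_mul_of_nonneg_left h3 (hM _ (hσpos r hr0).le)
    _ = (Real.exp (-(l * (σ t - σ r))) * M (σ r)) * (σ t * (σ t + α)) := by ring
    _ ≤ M (σ t) * (σ t * (σ t + α)) :=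
        mul_le_mul_of_nonneg_right h1 (mul_nonneg (hσpos t ht0).le (by linarith [hσpos t ht0]))

end TimeChange

/-- Eventual convexity of the mutual information along the Ornstein-Uhlenbeck flow started from a
distribution with bounded support. -/
theorem theorem2 {Ω : Type*} [MeasurableSpace Ω] (P : Measure Ω) [IsProbabilityMeasure P]
    (n : ℕ) (α : ℝ) (hα : 0 < α) (D : ℝ) (hD : 0 ≤ D)
    (X : ℝ → Ω → EuclideanSpace ℝ (Fin n)) (hX : IsOUProcess α X P)
    (hX0 : IsDBounded D (P.map (X 0))) :
    let T : ℝ := 1 / (2 * α) * Real.log (Real.sqrt (1 + D ^ 4 * α ^ 2) + D ^ 2 * α)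
    (∀ t : ℝ, T ≤ t → mutualInformation (X 0) (X t) P ≠ ∞) ∧
      ConvexOn ℝ (Set.Ici T) (fun t => (mutualInformation (X 0) (X t) P).toReal) := by
  intro T
  obtain ⟨c, hc⟩ := hX0
  have h0 := hX.aemeasurable 0 le_rfl
  have := Measure.isProbabilityMeasure_map h0
  have hR : ∀ᵐ x ∂(P.map (X 0)), ‖x - c‖ ≤ D / 2 := by
    filter_upwards [Measure.support_mem_ae (μ := P.map (X 0))] with x hx
    simpa [dist_eq_norm] using hc hx
  -- For D = 0 one has T = 0, where the channel description fails, but `X 0` is then almost surely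
  -- constant.
  rcases hD.eq_or_lt with rfl | hDpos
  · have hT : T = 0 := by simp [T]
    have hconst : X 0 =ᵐ[P] fun _ => c := by
      filter_upwards [ae_of_ae_map h0 hR] with ω hω
      rw [zero_div] at hω
      exact sub_eq_zero.1 (norm_le_zero_iff.1 hω)
    have hz : ∀ t, T ≤ t → mutualInformation (X 0) (X t) P = 0 := fun t ht =>
      mutualInformation_eq_zero_of_ae_eq_const hconst (hX.aemeasurable t (hT ▸ ht))
    refine ⟨fun t ht => by simp [hz t ht], (convexOn_const 0 (convex_Ici T)).congr fun t ht => ?_⟩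
    simp [hz t ht]
  · set w := Real.sqrt (1 + D ^ 4 * α ^ 2) + D ^ 2 * α with hw
    have hsq : Real.sqrt (1 + D ^ 4 * α ^ 2) ^ 2 = 1 + D ^ 4 * α ^ 2 :=
      Real.sq_sqrt (by positivity)
    have hw1 : 1 < w := by
      have h1 : 1 ≤ Real.sqrt (1 + D ^ 4 * α ^ 2) := by
        rw [Real.one_le_sqrt]
        have : 0 ≤ D ^ 4 * α ^ 2 := by positivity
        linarith
      have h2 : 0 < D ^ 2 * α := by positivity
      linarith
    have hTpos : 0 < T := mul_pos (by positivity) (Real.log_pos hw1)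
    have hexpT : Real.exp (2 * α * T) = w := by
      have : 2 * α * T = Real.log w := by
        simp only [T, ← hw]
        field_simp
      rw [this, Real.exp_log (by linarith)]
    have hB : ∀ᵐ x ∂(P.map (X 0)), ‖x‖ ≤ D / 2 + ‖c‖ := by
      filter_upwards [hR] with x hx
      calc ‖x‖ = ‖(x - c) + c‖ := by rw [sub_add_cancel]
        _ ≤ D / 2 + ‖c‖ := (norm_add_le _ _).trans (by gcongr)
    have hMI := fun t (ht : T ≤ t) => hX.mutualInformation_eq hα hB (hTpos.trans_le ht)
    refine ⟨fun t ht => (hMI t ht).1, ?_⟩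
    have hM : ∀ s, 0 ≤ s → 0 ≤ mmse (P.map (X 0)) s := fun s hs => mmse_nonneg hB hs
    have hle := fun s δ (hs : (0 : ℝ) ≤ s) (hδ : (0 : ℝ) ≤ δ) =>
      channelInformation_add_le hB hs hδ
    have hge := fun s δ (hs : (0 : ℝ) ≤ s) (hδ : (0 : ℝ) ≤ δ) hδR =>
      le_channelInformation_add hB hR hs hδ hδR
    have hconv := convexOn_comp_snr (l := 8 * (D / 2) ^ 2) hα hTpos
      (fun s hs => hasDerivAt_of_increments hM hle hge hs) hM
      (fun s r hs hsr => le_exp_mul_of_increments hle hge hs hsr)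
      -- Equality holds: w² = 1 + 2D²αw, and 8(D/2)² = 2D².
      (by rw [hexpT, hw]; nlinarith)
    exact hconv.congr fun t ht => ((hMI t ht).2).symm
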